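/- **Theorem (parabolic Dorronsoro theorem).** Let $n\ge 1$ and equip $\mathbb{R}^{n-1}\times\mathbb{R}$ with the parabolic metric $d((x,s),(y,t))=|x-y|+|s-t|^{1/2}$; $\operatorname{diam}$ denotes the diameter with respect to $d$, and $|\cdot|$ of a set denotes its Lebesgue measure. A *parabolic box* is a set $Q=I_1\times I_2$, where $I_1\subset\mathbb{R}^{n-1}$ is an axis-parallel cube of side-length $\ell(I_1)>0$ and $I_2\subset\mathbb{R}$ is an interval of length $\ell(I_1)^2$. For $j\in\mathbb{Z}$, let $\mathcal{D}_j$ be the family of boxes $I_1\times I_2$ with $I_1$ a standard dyadic cube of side-length $2^{-j}$ in $\mathbb{R}^{n-1}$ and $I_2$ a standard dyadic interval of length $2^{-2j}$, and let $\mathcal{D}=\bigcup_{j\in\mathbb{Z}}\mathcal{D}_j$. For $C\ge1$ write $CQ=CI_1\times CI_2$, where $CI_i$ is concentric with $I_i$ and has $C$ times its side-length. For continuous $\psi\colon\mathbb{R}^{n-1}\times\mathbb{R}\to\mathbb{R}$ and a box $S$ put $$\beta_2(S)=\inf_A\left(\frac{1}{\operatorname{diam}(S)^{n+1}}\int_S\left(\frac{|\psi(x,t)-A(x)|}{\operatorname{diam}(S)}\right)^2dx\,dt\right)^{1/2},$$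 where $A$ ranges over all affine maps $\mathbb{R}^{n-1}\to\mathbb{R}$ of the variable $x$ alone, and let $\beta_2^L(S)$ be the same quantity with the infimum restricted to affine maps of Lipschitz constant at most $L$. For every $n\ge1$ and $C\ge 1$ there is a constant $K=K(n,C)<\infty$ with the following property. Let $L,M\ge0$ and let $\psi\colon\mathbb{R}^{n-1}\times\mathbb{R}\to\mathbb{R}$ be a continuous function such that $$|\psi(x,t)-\psi(y,t)|\le L|x-y|\qquad(x,y\in\mathbb{R}^{n-1},\ t\in\mathbb{R})$$ and $$\frac1{|Q|}\int_{I_1}\iint_{I_2\times I_2}\frac{|\psi(x,t)-\psi(x,s)|^2}{|s-t|^2}\,ds\,dt\,dx\le M\qquad\text{for all parabolic boxes }Q=I_1\times I_2.$$ Then, for every $Q_0\in\mathcal{D}$, $$\sum_{Q\in\mathcal{D},\,Q\subset Q_0}\beta_2(CQ)^2|Q|\le K(L^2+M)|Q_0|.$$ Moreover, under the same assumptions, $\beta_2(CQ)$ can be replaced by $\beta_2^L(CQ)$: $$\sum_{Q\in\mathcal{D},\,Q\subset Q_0}\beta_2^L(CQ)^2|Q|\le K(L^2+M)|Q_0|\qquad\text{for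 every }Q_0\in\mathcal{D}.$$ -/

import Mathlib

open MeasureTheory
open scoped ENNReal NNReal

namespace ParabolicDorronsoro

/-- The space `ℝ^m × ℝ` of points `(x, t)`. With `n = m + 1` this is `ℝ^(n-1) × ℝ`. -/
abbrev Space (m : ℕ) : Type := EuclideanSpace ℝ (Fin m) × ℝ

/-- The parabolic distance `|x - y| + |s - t|^(1/2)`. -/
noncomputable def pdist {m : ℕ} (p q : Space m) : ℝ :=
  dist p.1 q.1 + Real.sqrt |p.2 - q.2|

/-- The diameter of a (nonempty, bounded) set in the parabolic distance. -/
noncomputable def pdiam {m : ℕ} (S : Set (Space m)) : ℝ :=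
  sSup {r : ℝ | ∃ p ∈ S, ∃ q ∈ S, r = pdist p q}

/-- Data of a box `I₁ × I₂`, where `I₁ ⊂ ℝ^m` is the axis-parallel cube with lower corner `corner`
and side-length `side`, and `I₂ ⊂ ℝ` is the interval with left endpoint `start` and length
`height`. -/
@[ext] structure Box (m : ℕ) where
  corner : EuclideanSpace ℝ (Fin m)
  side : ℝ
  start : ℝ
  height : ℝ

namespace Box

variable {m : ℕ}

/-- The cube `I₁`. -/
def base (Q : Box m) : Set (EuclideanSpace ℝ (Fin m)) :=
  {x | ∀ i, x i ∈ Set.Ico (Q.corner i) (Q.corner i + Q.side)}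

/-- The interval `I₂`. -/
def interval (Q : Box m) : Set ℝ := Set.Ico Q.start (Q.start + Q.height)

/-- The box `I₁ × I₂` as a set. -/
def toSet (Q : Box m) : Set (Space m) := Q.base ×ˢ Q.interval

/-- Parabolic boxes: `ℓ(I₁) > 0` and `|I₂| = ℓ(I₁)²`. -/
def IsParabolic (Q : Box m) : Prop := 0 < Q.side ∧ Q.height = Q.side ^ 2

/-- `C Q = C I₁ × C I₂`: both factors keep their centres, and their side-lengths are
multiplied by `C`. -/
noncomputable def dilate (C : ℝ) (Q : Box m) : Box m where
  corner := WithLp.toLp 2 fun i => Q.corner i - (C - 1) / 2 * Q.side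
  side := C * Q.side
  start := Q.start - (C - 1) / 2 * Q.height
  height := C * Q.height

end Box

/-- The dyadic parabolic box of generation `j` with position `(k, l)`: the product of the dyadic cube
`∏ᵢ [kᵢ 2^(-j), (kᵢ + 1) 2^(-j))` and the dyadic interval `[l 2^(-2j), (l + 1) 2^(-2j))`. -/
noncomputable def dyadicBox {m : ℕ} (j : ℤ) (k : Fin m → ℤ) (l : ℤ) : Box m where
  corner := WithLp.toLp 2 fun i => (k i : ℝ) * (2 : ℝ) ^ (-j)
  side := (2 : ℝ) ^ (-j)
  start := (l : ℝ) * (2 : ℝ) ^ (-(2 * j))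
  height := (2 : ℝ) ^ (-(2 * j))

/-- The family of all dyadic parabolic boxes, of all generations `j ∈ ℤ`. -/
def dyadicBoxes (m : ℕ) : Set (Box m) := {Q | ∃ j k l, Q = dyadicBox j k l}

/-- `|ψ(x,t) - ψ(y,t)| ≤ L |x - y|` for all `x, y, t`. -/
def HorizontallyLipschitz {m : ℕ} (L : ℝ≥0) (ψ : Space m → ℝ) : Prop :=
  ∀ (x y : EuclideanSpace ℝ (Fin m)) (t : ℝ), |ψ (x, t) - ψ (y, t)| ≤ L * dist x y

/-- The Carleson-type condition on time differences, with constant `M`: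
`|Q|⁻¹ ∫_{I₁} ∬_{I₂ × I₂} |ψ(x,t) - ψ(x,s)|² / |s - t|² ds dt dx ≤ M` for all parabolic boxes
`Q = I₁ × I₂` (dyadic or not). -/
def TimeCarleson {m : ℕ} (M : ℝ≥0) (ψ : Space m → ℝ) : Prop :=
  ∀ Q : Box m, Q.IsParabolic →
    (volume Q.toSet)⁻¹ *
      ∫⁻ x in Q.base, ∫⁻ t in Q.interval, ∫⁻ s in Q.interval,
        ENNReal.ofReal (|ψ (x, t) - ψ (x, s)| ^ 2 / |s - t| ^ 2) ≤ M

/-- The quantity minimised in the definition of the `β₂`-numbers (`n + 1 = m + 2`):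
`(diam(S)^(-(n+1)) ∫_S (|ψ(x,t) - A(x)| / diam(S))² dx dt)^(1/2)`. -/
noncomputable def affineError {m : ℕ} (ψ : Space m → ℝ) (S : Set (Space m))
    (A : EuclideanSpace ℝ (Fin m) →ᵃ[ℝ] ℝ) : ℝ≥0∞ :=
  ((ENNReal.ofReal (pdiam S ^ (m + 2)))⁻¹ *
    ∫⁻ p in S, ENNReal.ofReal ((|ψ p - A p.1| / pdiam S) ^ 2)) ^ (1 / 2 : ℝ)

/-- `β₂(S)`: infimum over all affine maps `A : ℝ^m → ℝ` of the variable `x` alone. -/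
noncomputable def beta₂ {m : ℕ} (ψ : Space m → ℝ) (S : Set (Space m)) : ℝ≥0∞ :=
  ⨅ A : EuclideanSpace ℝ (Fin m) →ᵃ[ℝ] ℝ, affineError ψ S A

/-- `β₂^L(S)`: infimum over the affine maps `A : ℝ^m → ℝ` with Lipschitz constant at most `L`. -/
noncomputable def restrictedBeta₂ {m : ℕ} (L : ℝ≥0) (ψ : Space m → ℝ) (S : Set (Space m)) :
    ℝ≥0∞ :=
  ⨅ A : {A : EuclideanSpace ℝ (Fin m) →ᵃ[ℝ] ℝ // LipschitzWith L A}, affineError ψ S A.1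

end ParabolicDorronsoro

open ParabolicDorronsoro

/-!
The `β₂`-numbers are at most the restricted ones, so only the latter are estimated. Fix a box `Q` of
side `η`, and let `(y, s)` be any point within parabolic distance comparable to `η` of `Q`. Take as
competitor the affine function which agrees with `f = ψ (·, s)` at `y` and at the points `y + η eᵢ`.
Its error splits into the oscillation of `ψ` in time and the deviation of `f` from its affine
interpolation, and averaging over `(y, s)` avoids having to select good base points.

The slope of this competitor may exceed `L`. By `exists_lipschitzWith_affineMap` the excess is
controlled by the error itself, so shrinking the slope costs only a constant.

*Deviation from affine functions.* Decomposing one coordinate at a time, and using the identity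
`∫₀¹ (g (u + θ) - g θ) dθ = u ∫₀¹ (g (1 + u θ) - g (u θ)) dθ` on lines (`line_defect_eq`), the
deviation at `y + η w` is a sum of averages of mixed differences of `f` based at `y` with steps comparable
to `η`; mixed differences are differences of second differences. For a fixed vector `a` the quotients
`sᵢ x = 2^i (f (x + 2^(-i) a) - f x)` are bounded by `L ‖a‖`, and the average of two values of
`sᵢ₊₁` is a value of `sᵢ`. By the parallelogram law, the increase of the energy `∫ |sᵢ|²` from one
scale to the next is the energy of a second difference (`sum_secondDiff_le`). Hence the second
differences, normalized by their scale, are square summable over all dyadic scales with total at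
most a constant times `L²` times the volume.

*Oscillation in time.* A pair of times at distance `δ` contributes only at the scales with
`η² ≳ δ`, with weight `η⁻⁴`; the sum of these weights is of order `δ⁻²`
(`tsum_nearDiagonal_le`), which is the kernel in the hypothesis on time differences.

The dyadic boxes of one generation are disjoint, so that the sum over them is an integral over
`Q₀` (`tsum_dyadic_le`), and the overlaps of their enlargements are handled by Fubini
(`lintegral_sections_le`).
-/

namespace ParabolicDorronsoro

/-! ### Squares and a Fubini estimate -/

/-- The square of a real number, as an extended nonnegative real. -/
noncomputable def esq (x : ℝ) : ℝ≥0∞ := ENNReal.ofReal (x ^ 2)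

lemma continuous_esq : Continuous esq :=
  ENNReal.continuous_ofReal.comp (continuous_pow 2)

lemma esq_le_esq {a b : ℝ} (h : |a| ≤ |b|) : esq a ≤ esq b :=
  ENNReal.ofReal_le_ofReal (sq_le_sq.2 h)

lemma esq_mul (a b : ℝ) : esq (a * b) = esq a * esq b := by
  rw [esq, esq, esq, mul_pow, ENNReal.ofReal_mul (sq_nonneg a)]

lemma esq_ne_top (a : ℝ) : esq a ≠ ∞ := ENNReal.ofReal_ne_top

lemma esq_neg (a : ℝ) : esq (-a) = esq a := by simp [esq]

lemma esq_add_le (a b : ℝ) : esq (a + b) ≤ 2 * (esq a + esq b) := by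
  rw [esq, esq, esq, ← ENNReal.ofReal_add (sq_nonneg a) (sq_nonneg b),
    ← ENNReal.ofReal_ofNat 2, ← ENNReal.ofReal_mul (by norm_num)]
  exact ENNReal.ofReal_le_ofReal (by nlinarith [sq_nonneg (a - b)])

lemma esq_sub_le (a b : ℝ) : esq (a - b) ≤ 2 * (esq a + esq b) := by
  simpa [sub_eq_add_neg, esq_neg] using esq_add_le a (-b)

/-- Jensen's inequality on the unit interval. -/
lemma esq_integral_le {g : ℝ → ℝ} (hg : Continuous g) :
    esq (∫ θ in (0 : ℝ)..1, g θ) ≤ ∫⁻ θ in Set.Ioc (0 : ℝ) 1, esq (g θ) := by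
  set c := ∫ θ in (0 : ℝ)..1, g θ with hc
  have h1 : 0 ≤ ∫ θ in (0 : ℝ)..1, (g θ - c) ^ 2 :=
    intervalIntegral.integral_nonneg (by norm_num) fun _ _ => sq_nonneg _
  have h2 : ∫ θ in (0 : ℝ)..1, (g θ - c) ^ 2 = (∫ θ in (0 : ℝ)..1, g θ ^ 2) - c ^ 2 := by
    have : ∀ θ, (g θ - c) ^ 2 = g θ ^ 2 - (2 * c * g θ - c ^ 2) := fun θ => by ring
    simp_rw [this]
    rw [intervalIntegral.integral_sub, intervalIntegral.integral_sub,
      intervalIntegral.integral_const_mul, ← hc]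
    · simp; ring
    all_goals exact Continuous.intervalIntegrable (by fun_prop) _ _
  have h3 : c ^ 2 ≤ ∫ θ in Set.Ioc (0 : ℝ) 1, g θ ^ 2 := by
    rw [← intervalIntegral.integral_of_le zero_le_one]; linarith
  calc esq c ≤ ENNReal.ofReal (∫ θ in Set.Ioc (0 : ℝ) 1, g θ ^ 2) := ENNReal.ofReal_le_ofReal h3
    _ = ∫⁻ θ in Set.Ioc (0 : ℝ) 1, esq (g θ) := by
      refine ofReal_integral_eq_lintegral_ofReal ?_ (Filter.Eventually.of_forall fun _ => sq_nonneg _)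
      exact ((hg.pow 2).integrableOn_Icc).mono_set Set.Ioc_subset_Icc_self

/-- If every point `p` lies in the sections `S(q)` for a set of `q`s of measure at most `κ`, then
integrating `F` over all the sections costs at most a factor `κ`. -/
lemma lintegral_sections_le {α β : Type*} [MeasurableSpace α] [MeasurableSpace β]
    {μ : Measure α} {ν : Measure β} [SFinite μ] [SFinite ν] {S : Set (α × β)}
    (hS : MeasurableSet S) {F : β → ℝ≥0∞} (hF : Measurable F) {κ : ℝ≥0∞} {A : Set α} {B : Set β}
    (hA : MeasurableSet A) (hB : MeasurableSet B) (hκ : ∀ p, μ {q | (q, p) ∈ S} ≤ κ)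
    (hSB : ∀ q ∈ A, ∀ p, (q, p) ∈ S → p ∈ B) :
    ∫⁻ q in A, ∫⁻ p in {p | (q, p) ∈ S}, F p ∂ν ∂μ ≤ κ * ∫⁻ p in B, F p ∂ν := by
  have hSq : ∀ q, MeasurableSet {p | (q, p) ∈ S} := fun q => measurable_prodMk_left hS
  have hSp : ∀ p, MeasurableSet {q | (q, p) ∈ S} := fun p => measurable_prodMk_right hS
  calc ∫⁻ q in A, ∫⁻ p in {p | (q, p) ∈ S}, F p ∂ν ∂μ
      ≤ ∫⁻ q in A, ∫⁻ p in B, S.indicator (fun z => F z.2) (q, p) ∂ν ∂μ := by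
        refine setLIntegral_mono' hA fun q hq => ?_
        rw [← lintegral_indicator (hSq q), ← lintegral_indicator hB]
        refine lintegral_mono fun p => ?_
        by_cases hp : (q, p) ∈ S
        · simp [Set.indicator, hp, hSB q hq p hp]
        · simp [Set.indicator, hp]
    _ = ∫⁻ p in B, ∫⁻ q in A, S.indicator (fun z => F z.2) (q, p) ∂μ ∂ν := by
        refine lintegral_lintegral_swap ?_
        exact ((hF.comp measurable_snd).indicator hS).aemeasurable
    _ ≤ ∫⁻ p in B, κ * F p ∂ν := by
        refine lintegral_mono fun p => ?_
        calc ∫⁻ q in A, S.indicator (fun z => F z.2) (q, p) ∂μ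
            ≤ ∫⁻ q, {q | (q, p) ∈ S}.indicator (fun _ => F p) q ∂μ := by
              refine (setLIntegral_le_lintegral _ _).trans (lintegral_mono fun q => ?_)
              by_cases hp : (q, p) ∈ S <;> simp [Set.indicator, hp]
          _ = F p * μ {q | (q, p) ∈ S} := lintegral_indicator_const (hSp p) _
          _ ≤ κ * F p := by rw [mul_comm]; gcongr; exact hκ p
    _ = κ * ∫⁻ p in B, F p ∂ν := lintegral_const_mul _ hF

/-- Translating the integrand is paid for by enlarging the ball. -/
lemma lintegral_closedBall_add_le {E : Type*} [NormedAddCommGroup E] [MeasurableSpace E]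
    [BorelSpace E] (μ : Measure E) [μ.IsAddRightInvariant] (F : E → ℝ≥0∞) (c v : E) {ρ ρ' : ℝ}
    (h : ρ + ‖v‖ ≤ ρ') :
    ∫⁻ x in Metric.closedBall c ρ, F (x + v) ∂μ ≤ ∫⁻ x in Metric.closedBall c ρ', F x ∂μ := by
  rw [← lintegral_indicator measurableSet_closedBall,
    ← lintegral_indicator measurableSet_closedBall,
    ← lintegral_add_right_eq_self ((Metric.closedBall c ρ').indicator F) v]
  refine lintegral_mono fun x => ?_
  by_cases hx : x ∈ Metric.closedBall c ρ
  · have : x + v ∈ Metric.closedBall c ρ' := by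
      rw [Metric.mem_closedBall, dist_eq_norm] at *
      calc ‖x + v - c‖ = ‖(x - c) + v‖ := by congr 1; abel
        _ ≤ _ := (norm_add_le _ _).trans (by linarith)
    simp [hx, this]
  · simp [hx]

/-! ### Second and mixed differences: the square function -/

lemma esq_parallelogram (p q : ℝ) : esq p + esq q = 2⁻¹ * (esq (p + q) + esq (p - q)) := by
  have h2 : (2⁻¹ : ℝ≥0∞) = ENNReal.ofReal 2⁻¹ := by
    rw [ENNReal.ofReal_inv_of_pos (by norm_num), ENNReal.ofReal_ofNat]
  rw [esq, esq, esq, esq, ← ENNReal.ofReal_add (sq_nonneg _) (sq_nonneg _),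
    ← ENNReal.ofReal_add (sq_nonneg _) (sq_nonneg _), h2, ← ENNReal.ofReal_mul (by norm_num)]
  congr 1; ring

section ScaleEnergy

variable {E : Type*} [NormedAddCommGroup E] [MeasurableSpace E] (μ : Measure E)

/-- The square function of a sequence `e` of functions, one for each dyadic scale `2^(-i)`, on the
ball `closedBall c ρ`. -/
noncomputable def scaleEnergy (c : E) (ρ : ℝ) (e : ℕ → E → ℝ) : ℝ≥0∞ :=
  ∑' i, esq (2 ^ i) * ∫⁻ x in Metric.closedBall c ρ, esq (e i x) ∂μ

variable {μ}

lemma scaleEnergy_zero (c : E) (ρ : ℝ) : scaleEnergy μ c ρ (fun _ _ => 0) = 0 := by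
  simp [scaleEnergy, esq]

lemma scaleEnergy_add_le [BorelSpace E] {c : E} {ρ : ℝ} {e e' : ℕ → E → ℝ} (he : ∀ i, Continuous (e i)) :
    scaleEnergy μ c ρ (fun i x => e i x + e' i x)
      ≤ 2 * (scaleEnergy μ c ρ e + scaleEnergy μ c ρ e') := by
  rw [scaleEnergy, scaleEnergy, scaleEnergy, ← ENNReal.tsum_add, ← ENNReal.tsum_mul_left]
  refine ENNReal.tsum_le_tsum fun i => ?_
  have hm : Measurable fun x => esq (e i x) := (continuous_esq.comp (he i)).measurable
  rw [← mul_add, ← lintegral_add_left hm, mul_left_comm, ← lintegral_const_mul' 2 _ (by simp)]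
  exact mul_le_mul_right (lintegral_mono fun x => esq_add_le _ _) _

lemma scaleEnergy_sub_le [BorelSpace E] {c : E} {ρ : ℝ} {e e' : ℕ → E → ℝ} (he : ∀ i, Continuous (e i)) :
    scaleEnergy μ c ρ (fun i x => e i x - e' i x)
      ≤ 2 * (scaleEnergy μ c ρ e + scaleEnergy μ c ρ e') := by
  have h := scaleEnergy_add_le (μ := μ) (c := c) (ρ := ρ) (e' := fun i x => -e' i x) he
  simpa [sub_eq_add_neg, scaleEnergy, esq_neg] using h

/-- The square function of an average over `θ` is at most the average of the square functions. -/
lemma scaleEnergy_integral_le [BorelSpace E] [SecondCountableTopology E] [SFinite μ]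
    {c : E} {ρ : ℝ}
    {g : ℕ → E → ℝ → ℝ}
    (hg : ∀ i, Continuous fun p : E × ℝ => g i p.1 p.2) {κ : ℝ≥0∞}
    (hκ : ∀ θ ∈ Set.Ioc (0 : ℝ) 1, scaleEnergy μ c ρ (fun i x => g i x θ) ≤ κ) :
    scaleEnergy μ c ρ (fun i x => ∫ θ in (0 : ℝ)..1, g i x θ) ≤ κ := by
  have hm : ∀ i, Measurable fun p : E × ℝ => esq (g i p.1 p.2) := fun i =>
    (continuous_esq.comp (hg i)).measurable
  have hm' : ∀ i, Measurable fun p : ℝ × E => esq (g i p.2 p.1) := fun i =>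
    (hm i).comp measurable_swap
  calc scaleEnergy μ c ρ (fun i x => ∫ θ in (0 : ℝ)..1, g i x θ)
      ≤ ∑' i, ∫⁻ θ in Set.Ioc (0 : ℝ) 1,
          esq (2 ^ i) * ∫⁻ x in Metric.closedBall c ρ, esq (g i x θ) ∂μ := by
        refine ENNReal.tsum_le_tsum fun i => ?_
        rw [lintegral_const_mul _ (hm' i).lintegral_prod_right']
        gcongr
        rw [← lintegral_lintegral_swap (hm i).aemeasurable]
        refine lintegral_mono fun x => esq_integral_le ?_
        exact (hg i).comp (Continuous.prodMk_right x)
    _ = ∫⁻ θ in Set.Ioc (0 : ℝ) 1, scaleEnergy μ c ρ (fun i x => g i x θ) := by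
        simp_rw [scaleEnergy]
        rw [lintegral_tsum]
        exact fun i => ((hm' i).lintegral_prod_right'.const_mul _).aemeasurable
    _ ≤ ∫⁻ θ in Set.Ioc (0 : ℝ) 1, κ := setLIntegral_mono' measurableSet_Ioc hκ
    _ = κ := by simp

end ScaleEnergy

section SquareFunction

variable {E : Type*} [NormedAddCommGroup E] [NormedSpace ℝ E]

/-- The second difference of `f` with base point `x` and step `w`. -/
def secondDiff (f : E → ℝ) (x w : E) : ℝ := f (x + (2 : ℝ) • w) - 2 * f (x + w) + f x

/-- The mixed difference of `f` with base point `x` and steps `a` and `b`. -/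
def mixedDiff (f : E → ℝ) (x a b : E) : ℝ := f (x + a + b) - f (x + a) - f (x + b) + f x

/-- The two second differences are both centred at `x + (a + b) / 2`. -/
lemma mixedDiff_eq (f : E → ℝ) (x a b : E) :
    mixedDiff f x a b = secondDiff f x ((2⁻¹ : ℝ) • (a + b))
      - secondDiff f (x + b) ((2⁻¹ : ℝ) • (a - b)) := by
  have e1 : x + (2 : ℝ) • (2⁻¹ : ℝ) • (a + b) = x + a + b := by module
  have e2 : x + b + (2 : ℝ) • (2⁻¹ : ℝ) • (a - b) = x + a := by module
  have e3 : x + b + (2⁻¹ : ℝ) • (a - b) = x + (2⁻¹ : ℝ) • (a + b) := by module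
  rw [mixedDiff, secondDiff, secondDiff, e1, e2, e3]; ring

variable [MeasurableSpace E] [BorelSpace E] {μ : Measure E} [μ.IsAddRightInvariant]

/-- The averages `s i x = 2^i (f (x + 2^(-i) a) - f x)` of the derivative of `f` along `a` satisfy
`s i x = (s (i + 1) x + s (i + 1) (x + 2^(-i-1) a)) / 2`, so by the parallelogram law the energy of
`s (i + 1)` exceeds that of `s i` by the energy of a second difference. The balls grow with `i` to
absorb the translations. -/
lemma sum_secondDiff_le {f : E → ℝ} (hf : Continuous f) {L : ℝ}
    (hL : ∀ x y, |f x - f y| ≤ L * dist x y) (c a : E) (ρ : ℝ) (n : ℕ) :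
    ∑ i ∈ Finset.range n, ∫⁻ x in Metric.closedBall c ρ,
        esq (2 ^ i * secondDiff f x (((2 : ℝ)⁻¹ ^ (i + 1)) • a)) ∂μ
      ≤ esq (L * ‖a‖) * μ (Metric.closedBall c (ρ + ‖a‖)) := by
  set s : ℕ → E → ℝ := fun i x => 2 ^ i * (f (x + ((2 : ℝ)⁻¹ ^ i) • a) - f x) with hs
  set R : ℕ → ℝ := fun i => ρ + (1 - (2 : ℝ)⁻¹ ^ i) * ‖a‖ with hR
  have hpow : ∀ i : ℕ, (2 : ℝ)⁻¹ ^ i ≤ 1 := fun i => pow_le_one₀ (by norm_num) (by norm_num)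
  have hpow0 : ∀ i : ℕ, 0 < (2 : ℝ)⁻¹ ^ i := fun i => by positivity
  have hmul : ∀ i : ℕ, (2 : ℝ) ^ i * (2 : ℝ)⁻¹ ^ i = 1 := fun i => by
    rw [← mul_pow]; norm_num
  have hsc : ∀ i, Continuous (s i) := fun i => by
    simp only [hs]; fun_prop
  have hsm : ∀ i, Measurable fun x => esq (s i x) := fun i =>
    (continuous_esq.comp (hsc i)).measurable
  have key : ∀ n, ∑ i ∈ Finset.range n, ∫⁻ x in Metric.closedBall c ρ,
        esq (2 ^ i * secondDiff f x (((2 : ℝ)⁻¹ ^ (i + 1)) • a)) ∂μ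
      ≤ ∫⁻ x in Metric.closedBall c (R n), esq (s n x) ∂μ := by
    intro n
    induction n with
    | zero => simp
    | succ n ih =>
      rw [Finset.sum_range_succ]
      set w := ((2 : ℝ)⁻¹ ^ (n + 1)) • a with hw
      have hρR : ρ ≤ R n := by
        have := mul_nonneg (sub_nonneg.2 (hpow n)) (norm_nonneg a)
        simp only [hR]; linarith
      have hRR : R n + ‖w‖ = R (n + 1) := by
        simp only [hR, hw, norm_smul, Real.norm_eq_abs, abs_of_pos (hpow0 (n + 1))]
        ring
      have hpt : ∀ x, esq (s n x) + esq (2 ^ n * secondDiff f x w)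
          = 2⁻¹ * (esq (s (n + 1) (x + w)) + esq (s (n + 1) x)) := by
        intro x
        have e1 : x + (2 : ℝ) • w = x + ((2 : ℝ)⁻¹ ^ n) • a := by
          rw [hw, smul_smul]; congr 2; rw [pow_succ]; ring
        have e2 : x + w + w = x + ((2 : ℝ)⁻¹ ^ n) • a := by rw [← e1]; module
        rw [esq_parallelogram]
        congr 3
        · simp only [hs, secondDiff, ← hw, e1, e2]; ring
        · simp only [hs, secondDiff, ← hw, e1]; ring
      calc _ ≤ (∫⁻ x in Metric.closedBall c (R n), esq (s n x) ∂μ)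
            + ∫⁻ x in Metric.closedBall c (R n), esq (2 ^ n * secondDiff f x w) ∂μ := by
            refine add_le_add ih (lintegral_mono_set ?_)
            exact Metric.closedBall_subset_closedBall hρR
        _ = 2⁻¹ * ((∫⁻ x in Metric.closedBall c (R n), esq (s (n + 1) (x + w)) ∂μ)
            + ∫⁻ x in Metric.closedBall c (R n), esq (s (n + 1) x) ∂μ) := by
            rw [← lintegral_add_left (hsm n)]
            simp_rw [hpt]
            rw [lintegral_const_mul', lintegral_add_left]
            · exact (continuous_esq.comp ((hsc (n + 1)).comp (continuous_add_const w))).measurable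
            · simp
        _ ≤ 2⁻¹ * ((∫⁻ x in Metric.closedBall c (R (n + 1)), esq (s (n + 1) x) ∂μ)
            + ∫⁻ x in Metric.closedBall c (R (n + 1)), esq (s (n + 1) x) ∂μ) := by
            refine mul_le_mul_right (add_le_add ?_ (lintegral_mono_set ?_)) _
            · exact lintegral_closedBall_add_le μ (fun x => esq (s (n + 1) x)) c w hRR.le
            · exact Metric.closedBall_subset_closedBall (by linarith [norm_nonneg w])
        _ = _ := by
            rw [← two_mul, ← mul_assoc, ENNReal.inv_mul_cancel (by simp) (by simp), one_mul]
  refine (key n).trans ?_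
  calc _ ≤ ∫⁻ x in Metric.closedBall c (R n), esq (L * ‖a‖) ∂μ := by
        refine lintegral_mono fun x => esq_le_esq ?_
        have h1 := hL (x + ((2 : ℝ)⁻¹ ^ n) • a) x
        rw [dist_eq_norm, add_sub_cancel_left, norm_smul, Real.norm_eq_abs,
          abs_of_pos (hpow0 n)] at h1
        refine le_trans ?_ (le_abs_self _)
        simp only [hs]
        rw [abs_mul, abs_of_pos (by positivity : (0 : ℝ) < 2 ^ n)]
        calc _ ≤ 2 ^ n * (L * ((2 : ℝ)⁻¹ ^ n * ‖a‖)) := by gcongr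
          _ = (2 ^ n * (2 : ℝ)⁻¹ ^ n) * (L * ‖a‖) := by ring
          _ = _ := by rw [hmul, one_mul]
    _ = esq (L * ‖a‖) * μ (Metric.closedBall c (R n)) := by
        rw [lintegral_const, Measure.restrict_apply_univ]
    _ ≤ _ := by
        gcongr
        simp only [hR]
        nlinarith [hpow0 n, norm_nonneg a]

lemma scaleEnergy_secondDiff_le {f : E → ℝ} (hf : Continuous f) {L : ℝ}
    (hL : ∀ x y, |f x - f y| ≤ L * dist x y) (c a : E) (ρ : ℝ) :
    scaleEnergy μ c ρ (fun i x => secondDiff f x (((2 : ℝ)⁻¹ ^ i) • a))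
      ≤ esq (L * (2 * ‖a‖)) * μ (Metric.closedBall c (ρ + 2 * ‖a‖)) := by
  refine ENNReal.tsum_le_of_sum_range_le fun n => ?_
  have h := sum_secondDiff_le (μ := μ) hf hL c ((2 : ℝ) • a) ρ n
  rw [norm_smul, Real.norm_ofNat] at h
  refine le_trans (Finset.sum_le_sum fun i _ => ?_) h
  rw [← lintegral_const_mul' _ _ (esq_ne_top _)]
  refine lintegral_mono fun x => ?_
  rw [← esq_mul, smul_smul, pow_succ, mul_assoc, inv_mul_cancel₀ two_ne_zero, mul_one]

/-- The square function of mixed differences with steps `2^(-i) a` and `2^(-i) b`. -/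
lemma scaleEnergy_mixedDiff_le {f : E → ℝ} (hf : Continuous f) {L : ℝ} (hL0 : 0 ≤ L)
    (hL : ∀ x y, |f x - f y| ≤ L * dist x y) (c a b : E) (ρ : ℝ) {N : ℝ} (hN : ‖a‖ + ‖b‖ ≤ N) :
    scaleEnergy μ c ρ (fun i x => mixedDiff f x (((2 : ℝ)⁻¹ ^ i) • a) (((2 : ℝ)⁻¹ ^ i) • b))
      ≤ 4 * (esq (L * N) * μ (Metric.closedBall c (ρ + 2 * N))) := by
  have hN0 : 0 ≤ N := (by positivity : (0 : ℝ) ≤ ‖a‖ + ‖b‖).trans hN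
  have e : ∀ i x, mixedDiff f x (((2 : ℝ)⁻¹ ^ i) • a) (((2 : ℝ)⁻¹ ^ i) • b)
      = secondDiff f x (((2 : ℝ)⁻¹ ^ i) • (2⁻¹ : ℝ) • (a + b))
        - secondDiff f (x + ((2 : ℝ)⁻¹ ^ i) • b) (((2 : ℝ)⁻¹ ^ i) • (2⁻¹ : ℝ) • (a - b)) := by
    intro i x
    rw [mixedDiff_eq, ← smul_add, ← smul_sub, smul_comm, smul_comm (2⁻¹ : ℝ)]
  have hcont : ∀ (i : ℕ) v, Continuous fun x => secondDiff f x (((2 : ℝ)⁻¹ ^ i) • v) := fun i v => by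
    simp only [secondDiff]; fun_prop
  have hmain : ∀ (v : E) (ρ' : ℝ), 2 * ‖v‖ ≤ N → ρ' ≤ ρ + N →
      scaleEnergy μ c ρ' (fun i x => secondDiff f x (((2 : ℝ)⁻¹ ^ i) • v))
        ≤ esq (L * N) * μ (Metric.closedBall c (ρ + 2 * N)) := by
    intro v ρ' hv hρ'
    refine (scaleEnergy_secondDiff_le hf hL c v ρ').trans ?_
    refine mul_le_mul' (esq_le_esq ?_) (measure_mono ?_)
    · rw [abs_of_nonneg (by positivity), abs_of_nonneg (by positivity)]
      exact mul_le_mul_of_nonneg_left hv hL0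
    · exact Metric.closedBall_subset_closedBall (by linarith)
  have hnorm : ∀ v : E, 2 * ‖(2⁻¹ : ℝ) • v‖ = ‖v‖ := fun v => by
    rw [norm_smul, Real.norm_eq_abs, abs_of_pos (by norm_num)]; ring
  simp_rw [e]
  refine (scaleEnergy_sub_le fun i => hcont i _).trans ?_
  have h1 : scaleEnergy μ c ρ (fun i x => secondDiff f x (((2 : ℝ)⁻¹ ^ i) • (2⁻¹ : ℝ) • (a + b)))
      ≤ esq (L * N) * μ (Metric.closedBall c (ρ + 2 * N)) :=
    hmain _ _ ((hnorm _).le.trans ((norm_add_le _ _).trans hN)) (by linarith)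
  have h2 : scaleEnergy μ c ρ (fun i x => secondDiff f (x + ((2 : ℝ)⁻¹ ^ i) • b)
        (((2 : ℝ)⁻¹ ^ i) • (2⁻¹ : ℝ) • (a - b)))
      ≤ esq (L * N) * μ (Metric.closedBall c (ρ + 2 * N)) := by
    refine le_trans (ENNReal.tsum_le_tsum fun i => ?_)
      (hmain ((2⁻¹ : ℝ) • (a - b)) (ρ + N)
        ((hnorm _).le.trans ((norm_sub_le _ _).trans hN)) le_rfl)
    refine mul_le_mul_right ?_ _
    refine lintegral_closedBall_add_le μ
      (fun x => esq (secondDiff f x (((2 : ℝ)⁻¹ ^ i) • (2⁻¹ : ℝ) • (a - b)))) c _ ?_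
    have : ‖((2 : ℝ)⁻¹ ^ i) • b‖ ≤ ‖b‖ := by
      rw [norm_smul, Real.norm_eq_abs, abs_of_pos (by positivity)]
      exact mul_le_of_le_one_left (norm_nonneg b) (pow_le_one₀ (by norm_num) (by norm_num))
    linarith [norm_nonneg a]
  calc _ ≤ 2 * (esq (L * N) * μ (Metric.closedBall c (ρ + 2 * N))
        + esq (L * N) * μ (Metric.closedBall c (ρ + 2 * N))) := by gcongr
    _ = _ := by ring

end SquareFunction

/-! ### Deviation from affine functions -/

section LineDefect

variable {E : Type*} [NormedAddCommGroup E] [NormedSpace ℝ E]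

/-- On the line through `y` in direction `v`, the deviation of `f` from the linear interpolation
of its values at `y` and `y + v` is an average of mixed differences based at `y`. With
`g t = f (y + t v)` this amounts to
`∫₀¹ (g (u + θ) - g θ) dθ = u ∫₀¹ (g (1 + u θ) - g (u θ)) dθ`. -/
lemma line_defect_eq {f : E → ℝ} (hf : Continuous f) (y v : E) (u : ℝ) :
    f (y + u • v) - f y - u * (f (y + v) - f y)
      = u * (∫ θ in (0 : ℝ)..1, mixedDiff f y v ((u * θ) • v))
        - ∫ θ in (0 : ℝ)..1, mixedDiff f y (u • v) (θ • v) := by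
  set g : ℝ → ℝ := fun t => f (y + t • v) with hg
  have hgc : Continuous g := by simp only [hg]; fun_prop
  have hint : ∀ a b : ℝ, IntervalIntegrable g volume a b := fun a b => hgc.intervalIntegrable a b
  have e0 : f y = g 0 := by simp [hg]
  have e1 : f (y + v) = g 1 := by simp [hg]
  have h1 : ∀ θ : ℝ, mixedDiff f y v ((u * θ) • v) = g (1 + u * θ) - g 1 - g (u * θ) + g 0 := by
    intro θ
    rw [mixedDiff, e0, e1]
    simp only [hg, add_smul, one_smul, add_assoc]
  have h2 : ∀ θ : ℝ, mixedDiff f y (u • v) (θ • v) = g (u + θ) - g u - g θ + g 0 := by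
    intro θ
    rw [mixedDiff, e0]
    simp only [hg, add_smul, add_assoc]
  have i1 : u * ∫ θ in (0 : ℝ)..1, g (1 + u * θ) = ∫ t in (1 : ℝ)..(1 + u), g t := by
    simp
  have i2 : u * ∫ θ in (0 : ℝ)..1, g (u * θ) = ∫ t in (0 : ℝ)..u, g t := by
    simp
  have i3 : ∫ θ in (0 : ℝ)..1, g (u + θ) = ∫ t in u..(1 + u), g t := by
    simp [add_comm]
  have s1 : ∫ θ in (0 : ℝ)..1, mixedDiff f y v ((u * θ) • v)
      = (∫ θ in (0 : ℝ)..1, g (1 + u * θ)) - g 1 - (∫ θ in (0 : ℝ)..1, g (u * θ)) + g 0 := by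
    simp_rw [h1]
    rw [intervalIntegral.integral_add, intervalIntegral.integral_sub, intervalIntegral.integral_sub]
    · simp
    all_goals exact Continuous.intervalIntegrable (by fun_prop) _ _
  have s2 : ∫ θ in (0 : ℝ)..1, mixedDiff f y (u • v) (θ • v)
      = (∫ θ in (0 : ℝ)..1, g (u + θ)) - g u - (∫ θ in (0 : ℝ)..1, g θ) + g 0 := by
    simp_rw [h2]
    rw [intervalIntegral.integral_add, intervalIntegral.integral_sub, intervalIntegral.integral_sub]
    · simp
    all_goals exact Continuous.intervalIntegrable (by fun_prop) _ _
  have a1 := intervalIntegral.integral_add_adjacent_intervals (hint 0 1) (hint 1 (1 + u))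
  have a2 := intervalIntegral.integral_add_adjacent_intervals (hint 0 u) (hint u (1 + u))
  rw [s1, s2, e0, e1]
  change g u - g 0 - u * (g 1 - g 0) = _
  linear_combination (-1 : ℝ) * i1 + i2 + i3 + a2 - a1

variable [MeasurableSpace E] [BorelSpace E] {μ : Measure E} [μ.IsAddRightInvariant]

lemma scaleEnergy_mixedDiff_smul_le {f : E → ℝ} (hf : Continuous f) {L : ℝ} (hL0 : 0 ≤ L)
    (hL : ∀ x y, |f x - f y| ≤ L * dist x y) (c : E) (ρ : ℝ) {η : ℝ} (hη : 0 ≤ η) {a b : E} {N : ℝ}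
    (hN : ‖a‖ + ‖b‖ ≤ N) :
    scaleEnergy μ c ρ (fun i x => mixedDiff f x ((η * (2 : ℝ)⁻¹ ^ i) • a) ((η * (2 : ℝ)⁻¹ ^ i) • b))
      ≤ 4 * (esq (L * (η * N)) * μ (Metric.closedBall c (ρ + 2 * (η * N)))) := by
  have h := scaleEnergy_mixedDiff_le (μ := μ) hf hL0 hL c (η • a) (η • b) ρ (N := η * N) (by
    rw [norm_smul, norm_smul, Real.norm_eq_abs, abs_of_nonneg hη, ← mul_add]
    gcongr)
  simpa only [smul_smul, mul_comm η] using h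

/-- The square function of the deviations from linear interpolation along a line. -/
lemma scaleEnergy_lineDefect_le [SecondCountableTopology E] [SFinite μ] {f : E → ℝ}
    (hf : Continuous f) {L : ℝ} (hL0 : 0 ≤ L)
    (hL : ∀ x y, |f x - f y| ≤ L * dist x y) (c : E) (ρ : ℝ) {η : ℝ} (hη : 0 ≤ η) {v : E}
    (hv : ‖v‖ ≤ 1) {u R N : ℝ} (hu : |u| ≤ R) (hN : R + 1 ≤ N) :
    scaleEnergy μ c ρ (fun i x => f (x + u • (η * (2 : ℝ)⁻¹ ^ i) • v) - f x
        - u * (f (x + (η * (2 : ℝ)⁻¹ ^ i) • v) - f x))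
      ≤ 2 * (esq R + 1) * (4 * (esq (L * (η * N)) *
        μ (Metric.closedBall c (ρ + 2 * (η * N))))) := by
  set κ := 4 * (esq (L * (η * N)) * μ (Metric.closedBall c (ρ + 2 * (η * N)))) with hκ
  have hR : 0 ≤ R := (abs_nonneg u).trans hu
  set g₁ : ℕ → E → ℝ → ℝ := fun i x θ =>
    mixedDiff f x ((η * (2 : ℝ)⁻¹ ^ i) • v) ((u * θ) • (η * (2 : ℝ)⁻¹ ^ i) • v) with hg₁
  set g₂ : ℕ → E → ℝ → ℝ := fun i x θ =>
    mixedDiff f x (u • (η * (2 : ℝ)⁻¹ ^ i) • v) (θ • (η * (2 : ℝ)⁻¹ ^ i) • v) with hg₂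
  have hc₁ : ∀ i, Continuous fun p : E × ℝ => g₁ i p.1 p.2 := fun i => by
    simp only [hg₁, mixedDiff]; fun_prop
  have hc₂ : ∀ i, Continuous fun p : E × ℝ => g₂ i p.1 p.2 := fun i => by
    simp only [hg₂, mixedDiff]; fun_prop
  have hscale : ∀ t : ℝ, |t| ≤ N - 1 → ‖v‖ + ‖t • v‖ ≤ N := fun t ht => by
    rw [norm_smul, Real.norm_eq_abs]
    nlinarith [norm_nonneg v, abs_nonneg t]
  have b₁ : scaleEnergy μ c ρ (fun i x => ∫ θ in (0 : ℝ)..1, g₁ i x θ) ≤ κ := by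
    refine scaleEnergy_integral_le hc₁ fun θ hθ => ?_
    have h := scaleEnergy_mixedDiff_smul_le (μ := μ) hf hL0 hL c ρ hη (hscale (u * θ) (by
      rw [abs_mul, abs_of_pos hθ.1]; nlinarith [hθ.2, abs_nonneg u]))
    simpa only [hg₁, smul_comm (u * θ)] using h
  have b₂ : scaleEnergy μ c ρ (fun i x => ∫ θ in (0 : ℝ)..1, g₂ i x θ) ≤ κ := by
    refine scaleEnergy_integral_le hc₂ fun θ hθ => ?_
    have h := scaleEnergy_mixedDiff_smul_le (μ := μ) hf hL0 hL c ρ hη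
      (a := u • v) (b := θ • v) (N := N) (by
        rw [norm_smul, norm_smul, Real.norm_eq_abs, Real.norm_eq_abs, abs_of_pos hθ.1]
        nlinarith [norm_nonneg v, abs_nonneg u, hθ.1, hθ.2])
    simpa only [hg₂, smul_comm u, smul_comm θ] using h
  have b₃ : scaleEnergy μ c ρ (fun i x => u * ∫ θ in (0 : ℝ)..1, g₁ i x θ) ≤ esq R * κ := by
    refine le_trans ?_ (mul_le_mul_right b₁ _)
    rw [scaleEnergy, scaleEnergy, ← ENNReal.tsum_mul_left]
    refine ENNReal.tsum_le_tsum fun i => ?_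
    rw [mul_left_comm, ← lintegral_const_mul' (esq R) _ (esq_ne_top R)]
    refine mul_le_mul_right (lintegral_mono fun x => ?_) _
    rw [esq_mul]
    exact mul_le_mul_left (esq_le_esq (by rwa [abs_of_nonneg hR])) _
  simp_rw [line_defect_eq hf]
  refine (scaleEnergy_sub_le (e := fun i x => u * ∫ θ in (0 : ℝ)..1, g₁ i x θ) fun i => ?_).trans ?_
  · exact continuous_const.mul
      (intervalIntegral.continuous_parametric_intervalIntegral_of_continuous' (hc₁ i) 0 1)
  · calc _ ≤ 2 * (esq R * κ + κ) := mul_le_mul_right (add_le_add b₃ b₂) _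
      _ = _ := by ring

end LineDefect

variable {m : ℕ}

/-- The deviation at `y + η w` of `f` from the affine function which agrees with `f` at `y` and at
the points `y + η eᵢ`. -/
noncomputable def affineDefect (f : EuclideanSpace ℝ (Fin m) → ℝ) (η : ℝ)
    (y w : EuclideanSpace ℝ (Fin m)) : ℝ :=
  f (y + η • w) - f y - ∑ i, w i * (f (y + η • EuclideanSpace.single i 1) - f y)

/-- The square function of the deviations from affine functions. The deviation is decomposed one
coordinate at a time into mixed differences with base point `y`. -/
lemma exists_scaleEnergy_affineDefect_le (m : ℕ) {R : ℝ} (hR : 0 ≤ R) :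
    ∃ K : ℝ≥0∞, K ≠ ∞ ∧ ∀ (f : EuclideanSpace ℝ (Fin m) → ℝ) (L : ℝ), Continuous f → 0 ≤ L →
      (∀ x y, |f x - f y| ≤ L * dist x y) → ∀ (c : EuclideanSpace ℝ (Fin m)) (ρ η : ℝ), 0 ≤ η →
      ∀ w : EuclideanSpace ℝ (Fin m), ‖w‖ ≤ R →
        scaleEnergy volume c ρ (fun i y => affineDefect f (η * (2 : ℝ)⁻¹ ^ i) y w)
          ≤ K * (esq (L * (η * ((m + 1) * (R + 1)))) *
              volume (Metric.closedBall c (ρ + 2 * (η * ((m + 1) * (R + 1)))))) := by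
  classical
  set N : ℝ := (m + 1) * (R + 1) with hN
  have key : ∀ s : Finset (Fin m), ∃ K : ℝ≥0∞, K ≠ ∞ ∧
      ∀ (f : EuclideanSpace ℝ (Fin m) → ℝ) (L : ℝ), Continuous f → 0 ≤ L →
      (∀ x y, |f x - f y| ≤ L * dist x y) → ∀ (c : EuclideanSpace ℝ (Fin m)) (ρ η : ℝ), 0 ≤ η →
      ∀ w : EuclideanSpace ℝ (Fin m), ‖w‖ ≤ R →
        scaleEnergy volume c ρ (fun i y =>
          f (y + (η * (2 : ℝ)⁻¹ ^ i) • ∑ k ∈ s, w k • EuclideanSpace.single k (1 : ℝ)) - f y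
            - ∑ k ∈ s, w k * (f (y + (η * (2 : ℝ)⁻¹ ^ i) • EuclideanSpace.single k 1) - f y))
          ≤ K * (esq (L * (η * N)) * volume (Metric.closedBall c (ρ + 2 * (η * N)))) := by
    intro s
    induction s using Finset.induction_on with
    | empty =>
      refine ⟨0, by simp, fun f L _ _ _ c ρ η _ w _ => ?_⟩
      simp [scaleEnergy_zero]
    | insert k s hk ih =>
      obtain ⟨K, hK, ih⟩ := ih
      refine ⟨2 * (K + 2 * (4 + 2 * (esq R + 1) * 4)), ?_, ?_⟩
      · have := esq_ne_top R
        finiteness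
      intro f L hf hL0 hL c ρ η hη w hw
      have hwk : ∀ k, |w k| ≤ R := fun k => (PiLp.norm_apply_le w k).trans hw
      set δ := ∑ k ∈ s, w k • EuclideanSpace.single k (1 : ℝ) with hδ
      set e := (EuclideanSpace.single k (1 : ℝ) : EuclideanSpace ℝ (Fin m)) with he
      have hδn : ‖δ‖ ≤ m * R := by
        calc ‖δ‖ ≤ ∑ k ∈ s, ‖w k • (EuclideanSpace.single k (1 : ℝ) : EuclideanSpace ℝ (Fin m))‖ :=
              norm_sum_le _ _
          _ ≤ ∑ _k ∈ s, R := by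
              refine Finset.sum_le_sum fun k _ => ?_
              rw [norm_smul, PiLp.norm_single, norm_one, mul_one]
              exact hwk k
          _ ≤ m * R := by
              rw [Finset.sum_const, nsmul_eq_mul]
              gcongr
              exact_mod_cast (Finset.card_le_univ s).trans (by simp)
      have hen : ‖e‖ = 1 := by simp [he]
      set V := esq (L * (η * N)) * volume (Metric.closedBall c (ρ + 2 * (η * N))) with hV
      have hsplit : ∀ (i : ℕ) (y : EuclideanSpace ℝ (Fin m)),
          f (y + (η * (2 : ℝ)⁻¹ ^ i) • ∑ k ∈ insert k s, w k • EuclideanSpace.single k (1 : ℝ)) - f y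
            - ∑ k ∈ insert k s,
                w k * (f (y + (η * (2 : ℝ)⁻¹ ^ i) • EuclideanSpace.single k 1) - f y)
          = (f (y + (η * (2 : ℝ)⁻¹ ^ i) • δ) - f y
              - ∑ k ∈ s, w k * (f (y + (η * (2 : ℝ)⁻¹ ^ i) • EuclideanSpace.single k 1) - f y))
            + (mixedDiff f y ((η * (2 : ℝ)⁻¹ ^ i) • w k • e) ((η * (2 : ℝ)⁻¹ ^ i) • δ)
              + (f (y + w k • (η * (2 : ℝ)⁻¹ ^ i) • e) - f y
                - w k * (f (y + (η * (2 : ℝ)⁻¹ ^ i) • e) - f y))) := by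
        intro i y
        rw [Finset.sum_insert hk, Finset.sum_insert hk, mixedDiff, smul_add, ← hδ, ← he,
          smul_comm (w k), ← add_assoc]
        ring
      simp_rw [hsplit]
      have h1 := ih f L hf hL0 hL c ρ η hη w hw
      have h2 : scaleEnergy volume c ρ (fun i y =>
          mixedDiff f y ((η * (2 : ℝ)⁻¹ ^ i) • w k • e) ((η * (2 : ℝ)⁻¹ ^ i) • δ)) ≤ 4 * V := by
        refine scaleEnergy_mixedDiff_smul_le hf hL0 hL c ρ hη ?_
        rw [norm_smul, hen, mul_one, Real.norm_eq_abs, hN]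
        nlinarith [hwk k]
      have h3 := scaleEnergy_lineDefect_le (μ := volume) hf hL0 hL c ρ hη hen.le (hwk k)
        (N := N) (by rw [hN]; nlinarith [(Nat.cast_nonneg m : (0 : ℝ) ≤ m)])
      calc _ ≤ 2 * (K * V + 2 * (4 * V + 2 * (esq R + 1) * (4 * V))) := by
            refine (scaleEnergy_add_le fun i => ?_).trans
              (mul_le_mul_right (add_le_add h1 ((scaleEnergy_add_le fun i => ?_).trans
                (mul_le_mul_right (add_le_add h2 h3) _))) _)
            · fun_prop
            · simp only [mixedDiff]; fun_prop
        _ = _ := by ring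
  obtain ⟨K, hK, h⟩ := key Finset.univ
  refine ⟨K, hK, fun f L hf hL0 hL c ρ η hη w hw => ?_⟩
  have hw' : ∑ k, w k • EuclideanSpace.single k (1 : ℝ) = w := by
    simpa using (EuclideanSpace.basisFun (Fin m) ℝ).sum_repr w
  simpa only [hw', affineDefect] using h f L hf hL0 hL c ρ η hη w hw

/-! ### Competitors of restricted slope -/

lemma exists_affineMap_eq (a : ℝ) (b : EuclideanSpace ℝ (Fin m)) :
    ∃ A : EuclideanSpace ℝ (Fin m) →ᵃ[ℝ] ℝ, (∀ x, A x = a + inner ℝ b x) ∧ LipschitzWith ‖b‖₊ A := by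
  let A := (innerₛₗ ℝ b).toAffineMap + AffineMap.const ℝ (EuclideanSpace ℝ (Fin m)) a
  have hA : ∀ x, A x = a + inner ℝ b x := fun x => by
    simp [A, add_comm]
  refine ⟨A, hA, LipschitzWith.of_dist_le_mul fun x y => ?_⟩
  rw [hA, hA, Real.dist_eq, add_sub_add_left_eq_sub, ← inner_sub_right, dist_eq_norm]
  exact abs_real_inner_le_norm b (x - y)

lemma volume_closedBall_eq (c : EuclideanSpace ℝ (Fin m)) {r : ℝ} (hr : 0 ≤ r) (R : ℝ) (hR : 0 ≤ R) :
    volume (Metric.closedBall c (r * R))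
      = ENNReal.ofReal r ^ m * volume (Metric.closedBall (0 : EuclideanSpace ℝ (Fin m)) R) := by
  rw [Measure.addHaar_closedBall' _ _ (by positivity), Measure.addHaar_closedBall' _ 0 hR, mul_pow,
    ENNReal.ofReal_mul (by positivity), finrank_euclideanSpace_fin, mul_assoc, ENNReal.ofReal_pow hr]

/-- An affine function of slope `b` may be replaced, at the cost of a constant factor in the `L²`
error on a ball, by one whose Lipschitz constant is at most that of `f`: comparing increments
along `b` shows that the excess `‖b‖ - L` of the slope is itself controlled by the error. -/
lemma exists_lipschitzWith_affineMap {f : EuclideanSpace ℝ (Fin m) → ℝ} (hf : Continuous f)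
    {L : ℝ≥0} (hL : ∀ x y, |f x - f y| ≤ L * dist x y) (c : EuclideanSpace ℝ (Fin m)) {r : ℝ}
    (hr : 0 < r) (a : ℝ) (b : EuclideanSpace ℝ (Fin m)) :
    ∃ A : EuclideanSpace ℝ (Fin m) →ᵃ[ℝ] ℝ, LipschitzWith L A ∧
      ∫⁻ x in Metric.closedBall c r, esq (f x - A x)
        ≤ (2 + 32 * 2 ^ m) *
          ∫⁻ x in Metric.closedBall c r, esq (f x - (a + inner ℝ b x)) := by
  rcases le_or_gt ‖b‖ L with hb | hb
  · obtain ⟨A, hA, hAL⟩ := exists_affineMap_eq a b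
    refine ⟨A, hAL.weaken hb, ?_⟩
    simp_rw [hA]
    calc _ = 1 * ∫⁻ x in Metric.closedBall c r, esq (f x - (a + inner ℝ b x)) := (one_mul _).symm
      _ ≤ _ := mul_le_mul_left (le_trans (by norm_num) (le_self_add)) _
  have hb0 : 0 < ‖b‖ := L.2.trans_lt hb
  -- The new slope `L v` points in the direction of `b`, and differs from it by `κ v`.
  set κ := ‖b‖ - L with hκ
  have hκ0 : 0 < κ := sub_pos.2 hb
  set v := ‖b‖⁻¹ • b with hv
  have hvn : ‖v‖ = 1 := by rw [hv, norm_smul, norm_inv, norm_norm, inv_mul_cancel₀ hb0.ne']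
  have hbv : inner ℝ b v = ‖b‖ := by
    rw [hv, inner_smul_right, real_inner_self_eq_norm_sq]; field_simp
  obtain ⟨A, hA, hAL⟩ := exists_affineMap_eq (a + κ * inner ℝ v c) ((L : ℝ) • v)
  refine ⟨A, hAL.weaken ?_, ?_⟩
  · rw [nnnorm_smul]
    have : ‖v‖₊ = 1 := by ext; simpa using hvn
    rw [this, mul_one]; simp
  set g : EuclideanSpace ℝ (Fin m) → ℝ := fun x => f x - (a + inner ℝ b x) with hg
  have hgc : Continuous g := by simp only [hg]; fun_prop
  have hgm : Measurable fun x => esq (g x) := (continuous_esq.comp hgc).measurable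
  set I := ∫⁻ x in Metric.closedBall c r, esq (g x) with hI
  have hbκ : b = (κ + L) • v := by
    rw [hκ, sub_add_cancel, hv, smul_smul, mul_inv_cancel₀ hb0.ne', one_smul]
  have hdiff : ∀ x, f x - A x = g x + κ * inner ℝ v (x - c) := by
    intro x
    have hbx : inner ℝ b x = (κ + L) * inner ℝ v x := by
      conv_lhs => rw [hbκ]
      exact real_inner_smul_left v x _
    rw [hA, real_inner_smul_left v x, inner_sub_right]
    simp only [hg, hbx]
    ring
  have hslope : ∀ z, esq (κ * r / 2) ≤ 2 * (esq (g (z + (r / 2) • v)) + esq (g z)) := by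
    intro z
    refine le_trans (esq_le_esq ?_) (esq_sub_le _ _)
    have h1 := hL (z + (r / 2) • v) z
    rw [dist_eq_norm, add_sub_cancel_left, norm_smul, hvn, mul_one, Real.norm_eq_abs,
      abs_of_pos (by positivity : 0 < r / 2)] at h1
    have h2 : g (z + (r / 2) • v) - g z = (f (z + (r / 2) • v) - f z) - r / 2 * ‖b‖ := by
      simp only [hg]
      rw [inner_add_right, inner_smul_right, hbv]; ring
    rw [h2, abs_of_pos (by positivity)]
    refine le_trans ?_ (neg_le_abs _)
    have := (abs_le.1 h1).2
    rw [hκ]; nlinarith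
  have hvol : volume (Metric.closedBall c r) = 2 ^ m * volume (Metric.closedBall c (r / 2)) := by
    rw [show r = 2 * (r / 2) by ring, volume_closedBall_eq c (by norm_num) _ (by positivity),
      show 2 * (r / 2) / 2 = 1 * (r / 2) by ring,
      volume_closedBall_eq c (by norm_num) _ (by positivity)]
    simp
  have hhalf : esq (κ * r / 2) * volume (Metric.closedBall c (r / 2)) ≤ 4 * I := by
    calc _ = ∫⁻ z in Metric.closedBall c (r / 2), esq (κ * r / 2) := by
          rw [lintegral_const, Measure.restrict_apply_univ]
      _ ≤ ∫⁻ z in Metric.closedBall c (r / 2), 2 * (esq (g (z + (r / 2) • v)) + esq (g z)) :=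
          lintegral_mono hslope
      _ = 2 * ((∫⁻ z in Metric.closedBall c (r / 2), esq (g (z + (r / 2) • v)))
            + ∫⁻ z in Metric.closedBall c (r / 2), esq (g z)) := by
          rw [lintegral_const_mul' _ _ (by simp), lintegral_add_right _ hgm]
      _ ≤ 2 * (I + I) := by
          refine mul_le_mul_right (add_le_add ?_ (lintegral_mono_set ?_)) _
          · refine lintegral_closedBall_add_le volume (fun x => esq (g x)) c _ ?_
            rw [norm_smul, hvn, mul_one, Real.norm_eq_abs, abs_of_pos (by positivity)]
            linarith
          · exact Metric.closedBall_subset_closedBall (by linarith)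
      _ = 4 * I := by ring
  calc ∫⁻ x in Metric.closedBall c r, esq (f x - A x)
      ≤ ∫⁻ x in Metric.closedBall c r, 2 * (esq (g x) + esq (κ * r)) := by
        refine setLIntegral_mono' measurableSet_closedBall fun x hx => ?_
        rw [hdiff]
        refine (esq_add_le _ _).trans (mul_le_mul_right (add_le_add le_rfl (esq_le_esq ?_)) _)
        rw [abs_mul, abs_mul]
        refine mul_le_mul_of_nonneg_left ?_ (abs_nonneg _)
        rw [abs_of_pos hr]
        refine (abs_real_inner_le_norm _ _).trans ?_
        rw [hvn, one_mul, ← dist_eq_norm]; exact hx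
    _ = 2 * (I + esq (κ * r) * volume (Metric.closedBall c r)) := by
        rw [lintegral_const_mul' _ _ (by simp), lintegral_add_right _ measurable_const,
          lintegral_const, Measure.restrict_apply_univ]
    _ = 2 * I + 8 * 2 ^ m * (esq (κ * r / 2) * volume (Metric.closedBall c (r / 2))) := by
        have : esq (κ * r) = 4 * esq (κ * r / 2) := by
          rw [show κ * r = 2 * (κ * r / 2) by ring, esq_mul, esq]
          norm_num
        rw [this, hvol]; ring
    _ ≤ 2 * I + 8 * 2 ^ m * (4 * I) := by gcongr
    _ = _ := by ring

/-! ### Bounding the β-number of one box -/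

lemma norm_le_of_forall_abs_le {v : EuclideanSpace ℝ (Fin m)} {b : ℝ} (h : ∀ i, |v i| ≤ b) :
    ‖v‖ ≤ m * b := by
  have hv : ∑ k, v k • EuclideanSpace.single k (1 : ℝ) = v := by
    simpa using (EuclideanSpace.basisFun (Fin m) ℝ).sum_repr v
  calc ‖v‖ = ‖∑ k, v k • (EuclideanSpace.single k (1 : ℝ) : EuclideanSpace ℝ (Fin m))‖ := by rw [hv]
    _ ≤ ∑ k : Fin m, b := by
        refine (norm_sum_le _ _).trans (Finset.sum_le_sum fun k _ => ?_)
        rw [norm_smul, PiLp.norm_single, norm_one, mul_one]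
        exact h k
    _ = m * b := by simp

/-- The product of the balls of radii `r` and `ρ` around the two components of a point. -/
def cylinder (q : Space m) (r ρ : ℝ) : Set (Space m) :=
  Metric.closedBall q.1 r ×ˢ Metric.closedBall q.2 ρ

lemma measurableSet_cylinder (q : Space m) (r ρ : ℝ) : MeasurableSet (cylinder q r ρ) :=
  measurableSet_closedBall.prod measurableSet_closedBall

/-- `Box.dilate` multiplies the height by `C` only, hence the radius `C η²` in time. -/
lemma Box.dilate_toSet_subset_cylinder {C : ℝ} (hC : 1 ≤ C) {Q : Box m} (hQ : Q.IsParabolic)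
    {q : Space m} (hq : q ∈ Q.toSet) :
    (Q.dilate C).toSet ⊆ cylinder q (Q.side * ((m + 1) * C)) (C * Q.side ^ 2) := by
  obtain ⟨hs, hh⟩ := hQ
  have hη2 : 0 < Q.side ^ 2 := by positivity
  rintro ⟨x, t⟩ ⟨hx, ht⟩
  obtain ⟨hu, hτ⟩ := hq
  simp only [Box.base, Box.interval, Box.dilate, Set.mem_ofPred_eq, Set.mem_Ico] at hx ht hu hτ
  refine ⟨?_, ?_⟩
  · rw [Metric.mem_closedBall, dist_eq_norm]
    refine (norm_le_of_forall_abs_le (b := C * Q.side) fun i => ?_).trans ?_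
    · have h1 := hx i
      have h2 := hu i
      rw [PiLp.sub_apply, abs_le]
      constructor <;> nlinarith [h1.1, h1.2, h2.1, h2.2]
    · nlinarith [mul_pos (zero_lt_one.trans_le hC) hs]
  · rw [Metric.mem_closedBall, Real.dist_eq, abs_le]
    rw [hh] at ht hτ
    constructor <;> nlinarith [ht.1, ht.2, hτ.1, hτ.2]

/-- The bound comes from the time direction, so that it also covers `m = 0`; boundedness of the set
of distances is needed because the supremum of an unbounded set of reals is `0`. -/
lemma Box.half_side_le_pdiam_dilate {C : ℝ} (hC : 1 ≤ C) {Q : Box m} (hQ : Q.IsParabolic) :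
    Q.side / 2 ≤ pdiam (Q.dilate C).toSet := by
  have hQ' := hQ
  obtain ⟨hs, hh⟩ := hQ'
  have hη2 : 0 < Q.side ^ 2 := by positivity
  have hC0 : 0 < C := zero_lt_one.trans_le hC
  have hq : ((Q.corner, Q.start) : Space m) ∈ Q.toSet := by
    refine ⟨fun i => ⟨le_rfl, by linarith⟩, ⟨le_rfl, by rw [hh]; linarith⟩⟩
  have hsub := Box.dilate_toSet_subset_cylinder hC hQ hq
  have hbdd : BddAbove {r : ℝ | ∃ p ∈ (Q.dilate C).toSet, ∃ p' ∈ (Q.dilate C).toSet,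
      r = pdist p p'} := by
    refine ⟨2 * (Q.side * ((m + 1) * C)) + Real.sqrt (2 * (C * Q.side ^ 2)), ?_⟩
    rintro _ ⟨p, hp, p', hp', rfl⟩
    obtain ⟨h1, h2⟩ := hsub hp
    obtain ⟨h3, h4⟩ := hsub hp'
    rw [Metric.mem_closedBall] at h1 h2 h3 h4
    refine add_le_add ?_ (Real.sqrt_le_sqrt ?_)
    · linarith [dist_triangle_right p.1 p'.1 Q.corner]
    · rw [← Real.dist_eq]
      linarith [dist_triangle_right p.2 p'.2 Q.start]
  have hbase : (Q.dilate C).corner ∈ (Q.dilate C).base := fun i =>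
    ⟨le_rfl, by simp only [Box.dilate]; nlinarith⟩
  refine le_trans ?_ (le_csSup hbdd ⟨((Q.dilate C).corner, (Q.dilate C).start + C * Q.side ^ 2 / 2),
    ⟨hbase, ?_⟩, ((Q.dilate C).corner, (Q.dilate C).start), ⟨hbase, ?_⟩, rfl⟩)
  · rw [pdist, dist_self, zero_add]
    refine Real.le_sqrt_of_sq_le ?_
    rw [add_sub_cancel_left, abs_of_pos (by positivity)]
    nlinarith
  · have := mul_pos hC0 hη2
    simp only [Box.interval, Box.dilate, hh, Set.mem_Ico]
    constructor <;> linarith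
  · have := mul_pos hC0 hη2
    simp only [Box.interval, Box.dilate, hh, Set.mem_Ico]
    constructor <;> linarith

lemma affineError_sq_le {ψ : Space m → ℝ} {S Z : Set (Space m)} (hSZ : S ⊆ Z) {d : ℝ} (hd : 0 < d)
    (hdS : d ≤ pdiam S) (A : EuclideanSpace ℝ (Fin m) →ᵃ[ℝ] ℝ) :
    affineError ψ S A ^ 2 ≤ ENNReal.ofReal d⁻¹ ^ (m + 4) * ∫⁻ p in Z, esq (ψ p - A p.1) := by
  have hp : 0 < pdiam S := hd.trans_le hdS
  rw [affineError, ← ENNReal.rpow_natCast, ← ENNReal.rpow_mul]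
  norm_num
  have h1 : (ENNReal.ofReal (pdiam S ^ (m + 2)))⁻¹ ≤ ENNReal.ofReal d⁻¹ ^ (m + 2) := by
    rw [← ENNReal.ofReal_inv_of_pos (by positivity), ← ENNReal.ofReal_pow (by positivity)]
    refine ENNReal.ofReal_le_ofReal ?_
    rw [inv_pow]
    gcongr
  have h2 : ∀ p : Space m, ENNReal.ofReal ((|ψ p - A p.1| / pdiam S) ^ 2)
      ≤ ENNReal.ofReal d⁻¹ ^ 2 * esq (ψ p - A p.1) := by
    intro p
    rw [esq, ← ENNReal.ofReal_pow (by positivity), ← ENNReal.ofReal_mul (by positivity)]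
    refine ENNReal.ofReal_le_ofReal ?_
    rw [div_eq_mul_inv, mul_pow, sq_abs, mul_comm]
    gcongr
  calc _ ≤ ENNReal.ofReal d⁻¹ ^ (m + 2) *
        ∫⁻ p in Z, ENNReal.ofReal d⁻¹ ^ 2 * esq (ψ p - A p.1) := by
        refine mul_le_mul' ?_ ((lintegral_mono_set hSZ).trans (lintegral_mono fun p => ?_))
        · simpa using h1
        · simpa using h2 p
    _ = _ := by
        rw [lintegral_const_mul' _ _ (by finiteness), ← mul_assoc, ← pow_add]

lemma lintegral_closedBall_scale (F : EuclideanSpace ℝ (Fin m) → ℝ≥0∞)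
    (hF : Measurable F) (y : EuclideanSpace ℝ (Fin m)) {η : ℝ} (hη : 0 < η) (R : ℝ) :
    ∫⁻ x in Metric.closedBall y (η * R), F x
      = ENNReal.ofReal η ^ m * ∫⁻ w in Metric.closedBall 0 R, F (y + η • w) := by
  set G : EuclideanSpace ℝ (Fin m) → ℝ≥0∞ :=
    (Metric.closedBall y (η * R)).indicator F with hG
  have hGm : Measurable G := hF.indicator measurableSet_closedBall
  have h1 : ∀ w, (Metric.closedBall (0 : EuclideanSpace ℝ (Fin m)) R).indicator
      (fun w => F (y + η • w)) w = G (y + η • w) := by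
    intro w
    have : w ∈ Metric.closedBall (0 : EuclideanSpace ℝ (Fin m)) R
        ↔ y + η • w ∈ Metric.closedBall y (η * R) := by
      rw [mem_closedBall_zero_iff, Metric.mem_closedBall, dist_eq_norm, add_sub_cancel_left,
        norm_smul, Real.norm_eq_abs, abs_of_pos hη, mul_le_mul_iff_right₀ hη]
    by_cases hw : w ∈ Metric.closedBall (0 : EuclideanSpace ℝ (Fin m)) R
    · rw [Set.indicator_of_mem hw, hG, Set.indicator_of_mem (this.1 hw)]
    · rw [Set.indicator_of_notMem hw, hG, Set.indicator_of_notMem (mt this.2 hw)]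
  rw [← lintegral_indicator measurableSet_closedBall, ← lintegral_indicator measurableSet_closedBall]
  simp_rw [h1]
  have h2 : ∫⁻ w, G (y + η • w) = ENNReal.ofReal (η ^ m)⁻¹ * ∫⁻ x, G x := by
    have h3 : ∫⁻ w, G (y + η • w) = ∫⁻ z, G (y + z)
        ∂(Measure.map (η • ·) (volume : Measure (EuclideanSpace ℝ (Fin m)))) :=
      (lintegral_map (hGm.comp (measurable_const_add y)) (measurable_const_smul η)).symm
    rw [h3, Measure.map_addHaar_smul _ hη.ne', lintegral_smul_measure, finrank_euclideanSpace_fin,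
      abs_of_pos (by positivity), lintegral_add_left_eq_self G y, smul_eq_mul]
  rw [h2, ← mul_assoc, ENNReal.ofReal_inv_of_pos (by positivity), ENNReal.ofReal_pow hη.le,
    ENNReal.mul_inv_cancel, one_mul]
  · have := ENNReal.ofReal_pos.2 hη
    positivity
  · finiteness

/-- The part of the error which comes from replacing `ψ` on the cylinder by its values at the fixed
time `s`. -/
noncomputable def timeOscillation (ψ : Space m → ℝ) (Z : Set (Space m)) (s : ℝ) : ℝ≥0∞ :=
  ∫⁻ p in Z, esq (ψ p - ψ (p.1, s))

/-- The squared deviation of `ψ`, at scale `η` and at the fixed time `p.2`, from the affine function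
interpolating it near `p.1`, integrated over the rescaled displacements `w` with `‖w‖ ≤ R`. -/
noncomputable def spaceOscillation (ψ : Space m → ℝ) (η R : ℝ) (p : Space m) : ℝ≥0∞ :=
  ∫⁻ w in Metric.closedBall 0 R, esq (affineDefect (fun x => ψ (x, p.2)) η p.1 w)

lemma measurable_timeOscillation {ψ : Space m → ℝ} (hψ : Continuous ψ) (Z : Set (Space m)) :
    Measurable (timeOscillation ψ Z) := by
  have : Measurable fun z : ℝ × Space m => esq (ψ z.2 - ψ (z.2.1, z.1)) :=
    (continuous_esq.comp (by fun_prop)).measurable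
  exact this.lintegral_prod_right'

lemma measurable_affineDefect {ψ : Space m → ℝ} (hψ : Continuous ψ) (η : ℝ) :
    Measurable fun z : Space m × EuclideanSpace ℝ (Fin m) =>
      esq (affineDefect (fun x => ψ (x, z.1.2)) η z.1.1 z.2) := by
  refine (continuous_esq.comp ?_).measurable
  unfold affineDefect
  fun_prop

lemma measurable_spaceOscillation {ψ : Space m → ℝ} (hψ : Continuous ψ) (η R : ℝ) :
    Measurable (spaceOscillation ψ η R) :=
  (measurable_affineDefect hψ η).lintegral_prod_right'

/-- For each base point `p` in the cylinder, the affine function interpolating `ψ` at time `p.2`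
near `p.1` is a competitor, once its slope has been reduced to at most `L`. -/
lemma restrictedBeta₂_sq_le_of_mem {C : ℝ} (hC : 1 ≤ C) {ψ : Space m → ℝ} (hψ : Continuous ψ)
    {L : ℝ≥0} (hL : HorizontallyLipschitz L ψ) {Q : Box m} (hQ : Q.IsParabolic) {q : Space m}
    (hq : q ∈ Q.toSet) {p : Space m}
    (hp : p ∈ cylinder q (Q.side * ((m + 1) * C)) (C * Q.side ^ 2)) :
    restrictedBeta₂ L ψ (Q.dilate C).toSet ^ 2 ≤
      ENNReal.ofReal (Q.side / 2)⁻¹ ^ (m + 4) *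
        (2 * timeOscillation ψ (cylinder q (Q.side * ((m + 1) * C)) (C * Q.side ^ 2)) p.2
          + 2 * (ENNReal.ofReal (2 * (C * Q.side ^ 2)) * ((2 + 32 * 2 ^ m) *
            (ENNReal.ofReal Q.side ^ m * spaceOscillation ψ Q.side (2 * ((m + 1) * C)) p)))) := by
  set η := Q.side with hη
  have hη0 : 0 < η := hQ.1
  have hC0 : 0 < C := zero_lt_one.trans_le hC
  set r := η * ((m + 1) * C) with hr
  set ρ := C * η ^ 2 with hρ
  have hr0 : 0 < r := by positivity
  obtain ⟨y, s⟩ := p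
  obtain ⟨u, τ⟩ := q
  set f : EuclideanSpace ℝ (Fin m) → ℝ := fun x => ψ (x, s) with hf
  have hfc : Continuous f := by simp only [hf]; fun_prop
  set D : Fin m → ℝ := fun i => f (y + η • EuclideanSpace.single i 1) - f y with hD
  set b : EuclideanSpace ℝ (Fin m) := WithLp.toLp 2 fun i => D i / η with hb
  obtain ⟨A, hAL, hA⟩ := exists_lipschitzWith_affineMap hfc (fun x y => hL x y s) u hr0
    (f y - inner ℝ b y) b
  have hdef : ∀ w, f (y + η • w) - (f y - inner ℝ b y + inner ℝ b (y + η • w))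
      = affineDefect f η y w := by
    intro w
    have : inner ℝ b w = ∑ i, w i * (D i / η) := by
      simp [PiLp.inner_apply, hb]
    rw [inner_add_right, inner_smul_right, this, affineDefect, Finset.mul_sum]
    have : ∀ i, η * (w i * (D i / η)) = w i * D i := fun i => by field_simp
    simp_rw [this]
    ring
  have hspace : ∫⁻ x in Metric.closedBall u r, esq (f x - A x) ≤ (2 + 32 * 2 ^ m) *
      (ENNReal.ofReal η ^ m * spaceOscillation ψ η (2 * ((m + 1) * C)) (y, s)) := by
    refine hA.trans (mul_le_mul_right ?_ _)
    calc _ ≤ ∫⁻ x in Metric.closedBall y (η * (2 * ((m + 1) * C))),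
          esq (f x - (f y - inner ℝ b y + inner ℝ b x)) := by
          refine lintegral_mono_set (Metric.closedBall_subset_closedBall' ?_)
          have h1 : dist y u ≤ r := hp.1
          rw [dist_comm] at h1
          rw [hr] at *; linarith
      _ = _ := by
          rw [lintegral_closedBall_scale _ _ y hη0]
          · simp_rw [hdef]; rfl
          · exact (continuous_esq.comp (by fun_prop)).measurable
  have hm1 : Measurable fun p : Space m => esq (ψ p - ψ (p.1, s)) :=
    (continuous_esq.comp (by fun_prop)).measurable
  have hAc : Continuous A := hAL.continuous
  calc restrictedBeta₂ L ψ (Q.dilate C).toSet ^ 2 ≤ affineError ψ (Q.dilate C).toSet A ^ 2 := by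
        gcongr
        exact iInf_le (fun A : {A : EuclideanSpace ℝ (Fin m) →ᵃ[ℝ] ℝ // LipschitzWith L A} =>
          affineError ψ (Q.dilate C).toSet A.1) ⟨A, hAL⟩
    _ ≤ ENNReal.ofReal (η / 2)⁻¹ ^ (m + 4) * ∫⁻ p in cylinder (u, τ) r ρ, esq (ψ p - A p.1) :=
        affineError_sq_le (Box.dilate_toSet_subset_cylinder hC hQ hq) (by positivity)
          (Box.half_side_le_pdiam_dilate hC hQ) A
    _ ≤ _ := by
        refine mul_le_mul_right ?_ _
        calc _ ≤ ∫⁻ p in cylinder (u, τ) r ρ,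
              2 * (esq (ψ p - ψ (p.1, s)) + esq (f p.1 - A p.1)) := by
              refine lintegral_mono fun p => ?_
              have : ψ p - A p.1 = (ψ p - ψ (p.1, s)) + (f p.1 - A p.1) := by simp [hf]
              simp only
              rw [this]
              exact esq_add_le _ _
          _ = 2 * timeOscillation ψ (cylinder (u, τ) r ρ) s
              + 2 * (ENNReal.ofReal (2 * ρ) * ∫⁻ x in Metric.closedBall u r, esq (f x - A x)) := by
              rw [lintegral_const_mul' _ _ (by simp), lintegral_add_left hm1, mul_add,
                timeOscillation]
              congr 2
              rw [cylinder, Measure.volume_eq_prod, setLIntegral_prod_symm]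
              · simp only [lintegral_const, Measure.restrict_apply_univ, Real.volume_closedBall]
                rw [mul_comm]
              · exact (continuous_esq.comp (by fun_prop)).aemeasurable
          _ ≤ _ := by gcongr

/-! ### Averaging over base points -/

lemma volume_cylinder (q : Space m) {η : ℝ} (hη : 0 < η) {R T : ℝ} (hR : 0 ≤ R) (hT : 0 ≤ T) :
    volume (cylinder q (η * R) (T * η ^ 2)) = ENNReal.ofReal η ^ (m + 2) *
      (volume (Metric.closedBall (0 : EuclideanSpace ℝ (Fin m)) R) * ENNReal.ofReal (2 * T)) := by
  rw [cylinder, Measure.volume_eq_prod, Measure.prod_prod, volume_closedBall_eq _ hη.le _ hR,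
    Real.volume_closedBall, ← mul_assoc 2, ENNReal.ofReal_mul (by positivity),
    ENNReal.ofReal_pow hη.le]
  ring

lemma inv_ofReal_pow_mul_ofReal_pow {η : ℝ} (hη : 0 < η) (j k : ℕ) :
    (ENNReal.ofReal η)⁻¹ ^ (j + k) * ENNReal.ofReal η ^ k = (ENNReal.ofReal η)⁻¹ ^ j := by
  rw [pow_add, mul_assoc, ← mul_pow, ENNReal.inv_mul_cancel, one_pow, mul_one]
  · exact (ENNReal.ofReal_pos.2 hη).ne'
  · exact ENNReal.ofReal_ne_top

/-- Averaging `restrictedBeta₂_sq_le_of_mem` over the base point. -/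
lemma exists_restrictedBeta₂_sq_le (m : ℕ) {C : ℝ} (hC : 1 ≤ C) :
    ∃ K : ℝ≥0∞, K ≠ ∞ ∧ ∀ (ψ : Space m → ℝ) (L : ℝ≥0), Continuous ψ → HorizontallyLipschitz L ψ →
      ∀ Q : Box m, Q.IsParabolic → ∀ q ∈ Q.toSet,
        restrictedBeta₂ L ψ (Q.dilate C).toSet ^ 2 ≤
          K * ((ENNReal.ofReal Q.side)⁻¹ ^ (4 + (m + 2)) *
              (∫⁻ s in Metric.closedBall q.2 (C * Q.side ^ 2),
                timeOscillation ψ (cylinder q (Q.side * ((m + 1) * C)) (C * Q.side ^ 2)) s)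
            + (ENNReal.ofReal Q.side)⁻¹ ^ (2 + (m + 2)) *
              ∫⁻ p in cylinder q (Q.side * ((m + 1) * C)) (C * Q.side ^ 2),
                spaceOscillation ψ Q.side (2 * ((m + 1) * C)) p) := by
  have hC0 : 0 < C := zero_lt_one.trans_le hC
  set R : ℝ := (m + 1) * C with hR
  have hR0 : 0 < R := by positivity
  set V := volume (Metric.closedBall (0 : EuclideanSpace ℝ (Fin m)) R) with hV
  set c := ENNReal.ofReal (2 * C) with hc
  have hV0 : V ≠ 0 := (Metric.measure_closedBall_pos volume _ hR0).ne'
  have hVt : V ≠ ∞ := measure_closedBall_lt_top.ne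
  have hc0 : c ≠ 0 := (ENNReal.ofReal_pos.2 (by positivity)).ne'
  have hct : c ≠ ∞ := ENNReal.ofReal_ne_top
  set K₁ : ℝ≥0∞ := 2 + 32 * 2 ^ m with hK₁
  refine ⟨(V * c)⁻¹ * 2 ^ (m + 4) * (2 * V + 2 * (c * K₁)), ?_, ?_⟩
  · have : V * c ≠ 0 := mul_ne_zero hV0 hc0
    finiteness
  intro ψ L hψ hL Q hQ q hq
  set η := Q.side with hη
  have hη0 : 0 < η := hQ.1
  set e := ENNReal.ofReal η with he
  have he0 : e ≠ 0 := (ENNReal.ofReal_pos.2 hη0).ne'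
  have het : e ≠ ∞ := ENNReal.ofReal_ne_top
  set Z := cylinder q (η * R) (C * η ^ 2) with hZ
  set β := restrictedBeta₂ L ψ (Q.dilate C).toSet ^ 2 with hβ
  set T := ∫⁻ s in Metric.closedBall q.2 (C * η ^ 2), timeOscillation ψ Z s with hT
  set W := ∫⁻ p in Z, spaceOscillation ψ η (2 * R) p with hW
  have hD : ENNReal.ofReal (η / 2)⁻¹ = 2 * e⁻¹ := by
    rw [inv_div, div_eq_mul_inv, ENNReal.ofReal_mul (by norm_num), ENNReal.ofReal_inv_of_pos hη0,
      ENNReal.ofReal_ofNat]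
  have hρ : ENNReal.ofReal (2 * (C * η ^ 2)) = c * e ^ 2 := by
    rw [← mul_assoc, ENNReal.ofReal_mul (by positivity), ENNReal.ofReal_pow hη0.le]
  have hvolZ : volume Z = e ^ (m + 2) * (V * c) := volume_cylinder q hη0 hR0.le hC0.le
  have hTm := measurable_timeOscillation hψ Z
  have hTm' : Measurable fun p : Space m => timeOscillation ψ Z p.2 := hTm.comp measurable_snd
  have hTZ : ∫⁻ p in Z, timeOscillation ψ Z p.2 = e ^ m * V * T := by
    have h : ∫⁻ p in Z, timeOscillation ψ Z p.2
        = ∫⁻ _y in Metric.closedBall q.1 (η * R), T := setLIntegral_prod _ hTm'.aemeasurable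
    rw [h, lintegral_const, Measure.restrict_apply_univ, volume_closedBall_eq _ hη0.le _ hR0.le,
      mul_comm]
  have hmain : β * volume Z ≤ (2 * e⁻¹) ^ (m + 4) *
      (2 * (e ^ m * V * T) + 2 * (c * e ^ 2 * (K₁ * (e ^ m * W)))) := by
    calc β * volume Z = ∫⁻ p in Z, β := by rw [lintegral_const, Measure.restrict_apply_univ]
      _ ≤ ∫⁻ p in Z, (2 * e⁻¹) ^ (m + 4) * (2 * timeOscillation ψ Z p.2
            + 2 * (c * e ^ 2 * (K₁ * (e ^ m * spaceOscillation ψ η (2 * R) p)))) := by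
          refine setLIntegral_mono' (measurableSet_cylinder _ _ _) fun p hp => ?_
          rw [← hD, ← hρ]
          exact restrictedBeta₂_sq_le_of_mem hC hψ hL hQ hq hp
      _ = _ := by
          rw [lintegral_const_mul' _ _ (by finiteness),
            lintegral_add_left (hTm'.const_mul 2),
            lintegral_const_mul' _ _ (by simp), lintegral_const_mul' _ _ (by simp),
            lintegral_const_mul' _ _ (by finiteness), lintegral_const_mul' _ _ (by finiteness),
            lintegral_const_mul' _ _ (by finiteness), hTZ]
  have hcancel : volume Z * (e⁻¹ ^ (m + 2) * (V * c)⁻¹) = 1 := by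
    rw [hvolZ, mul_mul_mul_comm, ← mul_pow, ENNReal.mul_inv_cancel he0 het, one_pow, one_mul,
      ENNReal.mul_inv_cancel (mul_ne_zero hV0 hc0) (by finiteness)]
  have hxe : e⁻¹ * e = 1 := ENNReal.inv_mul_cancel he0 het
  have hxm : e⁻¹ ^ m * e ^ m = 1 := by rw [← mul_pow, hxe, one_pow]
  calc β = β * volume Z * (e⁻¹ ^ (m + 2) * (V * c)⁻¹) := by rw [mul_assoc, hcancel, mul_one]
    _ ≤ (2 * e⁻¹) ^ (m + 4) *
      (2 * (e ^ m * V * T) + 2 * (c * e ^ 2 * (K₁ * (e ^ m * W)))) *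
        (e⁻¹ ^ (m + 2) * (V * c)⁻¹) := mul_le_mul_left hmain _
    _ = (V * c)⁻¹ * 2 ^ (m + 4) * (2 * V * ((e⁻¹ ^ m * e ^ m) * e⁻¹ ^ (4 + (m + 2)) * T)
          + 2 * (c * K₁) * ((e⁻¹ ^ m * e ^ m) * (e⁻¹ * e) ^ 2 * e⁻¹ ^ (2 + (m + 2)) * W)) := by
        ring
    _ ≤ (V * c)⁻¹ * 2 ^ (m + 4) * ((2 * V + 2 * (c * K₁)) * (e⁻¹ ^ (4 + (m + 2)) * T)
          + (2 * V + 2 * (c * K₁)) * (e⁻¹ ^ (2 + (m + 2)) * W)) := by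
        rw [hxm, hxe, one_pow, one_mul, one_mul, one_mul]
        gcongr
        · exact le_self_add
        · exact le_add_self
    _ = _ := by ring

lemma measurable_lintegral_sections {α β : Type*} [MeasurableSpace α] [MeasurableSpace β]
    {ν : Measure β} [SFinite ν] {S : Set (α × β)} (hS : MeasurableSet S) {F : β → ℝ≥0∞}
    (hF : Measurable F) : Measurable fun q => ∫⁻ p in {p | (q, p) ∈ S}, F p ∂ν := by
  have h : ∀ q, ∫⁻ p in {p | (q, p) ∈ S}, F p ∂ν
      = ∫⁻ p, S.indicator (fun z => F z.2) (q, p) ∂ν := by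
    intro q
    have hq : MeasurableSet {p | (q, p) ∈ S} := measurable_prodMk_left hS
    rw [← lintegral_indicator hq]
    rfl
  simp_rw [h]
  exact ((hF.comp measurable_snd).indicator hS).lintegral_prod_right'

/-- The pairs consisting of a point of a box and a further time, with time separation at most
`δ`. -/
def Box.nearDiagonal (B : Box m) (δ : ℝ) : Set (Space m × ℝ) :=
  (B.toSet ×ˢ B.interval) ∩ {z | |z.2 - z.1.2| ≤ δ}

lemma Box.measurableSet_base (B : Box m) : MeasurableSet B.base := by
  have : B.base = ⋂ i, (fun x : EuclideanSpace ℝ (Fin m) => x i) ⁻¹'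
      Set.Ico (B.corner i) (B.corner i + B.side) := by
    ext x; simp [Box.base]
  rw [this]
  exact MeasurableSet.iInter fun i => measurableSet_Ico.preimage (by fun_prop)

lemma Box.measurableSet_interval (B : Box m) : MeasurableSet B.interval := measurableSet_Ico

lemma Box.measurableSet_toSet (B : Box m) : MeasurableSet B.toSet :=
  B.measurableSet_base.prod B.measurableSet_interval

lemma Box.measurableSet_nearDiagonal (B : Box m) (δ : ℝ) : MeasurableSet (B.nearDiagonal δ) := by
  refine (B.measurableSet_toSet.prod B.measurableSet_interval).inter ?_
  exact measurableSet_le (by fun_prop) measurable_const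

/-- Integrated over all base points `q` in a box, the two parts of the bound for the `β`-numbers at
scale `η` are controlled by integrals over a window `B` containing all the cylinders involved. -/
lemma exists_lintegral_restrictedBeta₂_bound_le (m : ℕ) {C : ℝ} (hC : 1 ≤ C) :
    ∃ K : ℝ≥0∞, K ≠ ∞ ∧ ∀ (ψ : Space m → ℝ), Continuous ψ → ∀ (A B : Box m) (η : ℝ), 0 < η →
      (∀ q ∈ A.toSet, cylinder q (η * ((m + 1) * C)) (C * η ^ 2) ⊆ B.toSet) →
      ∫⁻ q in A.toSet, ((ENNReal.ofReal η)⁻¹ ^ (4 + (m + 2)) *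
              (∫⁻ s in Metric.closedBall q.2 (C * η ^ 2),
                timeOscillation ψ (cylinder q (η * ((m + 1) * C)) (C * η ^ 2)) s)
            + (ENNReal.ofReal η)⁻¹ ^ (2 + (m + 2)) *
              ∫⁻ p in cylinder q (η * ((m + 1) * C)) (C * η ^ 2),
                spaceOscillation ψ η (2 * ((m + 1) * C)) p)
        ≤ K * ((ENNReal.ofReal η)⁻¹ ^ 4 *
            (∫⁻ z in B.nearDiagonal (2 * (C * η ^ 2)), esq (ψ z.1 - ψ (z.1.1, z.2)))
          + (ENNReal.ofReal η)⁻¹ ^ 2 *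
            ∫⁻ p in B.toSet, spaceOscillation ψ η (2 * ((m + 1) * C)) p) := by
  have hC0 : 0 < C := zero_lt_one.trans_le hC
  set R : ℝ := (m + 1) * C with hR
  have hR0 : 0 < R := by positivity
  set κ := volume (Metric.closedBall (0 : EuclideanSpace ℝ (Fin m)) R) * ENNReal.ofReal (2 * C)
    with hκ
  refine ⟨κ, by have := (measure_closedBall_lt_top (μ := volume)
    (x := (0 : EuclideanSpace ℝ (Fin m))) (r := R)).ne; finiteness, ?_⟩
  intro ψ hψ A B η hη hAB
  set e := ENNReal.ofReal η with he
  set ρ := C * η ^ 2 with hρ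
  have hρ0 : 0 < ρ := by positivity
  have hcyl : ∀ q : Space m, volume (cylinder q (η * R) ρ) = e ^ (m + 2) * κ := fun q =>
    volume_cylinder q hη hR0.le hC0.le
  set S₁ : Set (Space m × (Space m × ℝ)) :=
    {z | z.2.1 ∈ cylinder z.1 (η * R) ρ ∧ z.2.2 ∈ Metric.closedBall z.1.2 ρ} with hS₁
  set S₂ : Set (Space m × Space m) := {z | z.2 ∈ cylinder z.1 (η * R) ρ} with hS₂
  have hS₂m : MeasurableSet S₂ :=
    (measurableSet_le (f := fun z : Space m × Space m => dist z.2.1 z.1.1) (by fun_prop)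
      measurable_const).inter
    (measurableSet_le (f := fun z : Space m × Space m => dist z.2.2 z.1.2) (by fun_prop)
      measurable_const)
  have hS₁m : MeasurableSet S₁ :=
    (hS₂m.preimage (f := fun z : Space m × (Space m × ℝ) => (z.1, z.2.1)) (by fun_prop)).inter
    (measurableSet_le (f := fun z : Space m × (Space m × ℝ) => dist z.2.2 z.1.2) (by fun_prop)
      measurable_const)
  have hF₁ : Measurable fun z : Space m × ℝ => esq (ψ z.1 - ψ (z.1.1, z.2)) :=
    (continuous_esq.comp (by fun_prop)).measurable
  have hF₂ := measurable_spaceOscillation hψ η (2 * R)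
  have hsymm : ∀ p q : Space m, p ∈ cylinder q (η * R) ρ → q ∈ cylinder p (η * R) ρ := by
    rintro p q ⟨h1, h2⟩
    exact ⟨Metric.mem_closedBall_comm.1 h1, Metric.mem_closedBall_comm.1 h2⟩
  have hTS : ∀ q : Space m, ∫⁻ s in Metric.closedBall q.2 ρ,
      timeOscillation ψ (cylinder q (η * R) ρ) s
        = ∫⁻ z in {z | (q, z) ∈ S₁}, esq (ψ z.1 - ψ (z.1.1, z.2)) := by
    intro q
    have : {z | (q, z) ∈ S₁} = cylinder q (η * R) ρ ×ˢ Metric.closedBall q.2 ρ := rfl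
    rw [this, Measure.volume_eq_prod, setLIntegral_prod_symm _ hF₁.aemeasurable]
    rfl
  have h₁ : ∫⁻ q in A.toSet, ∫⁻ z in {z | (q, z) ∈ S₁}, esq (ψ z.1 - ψ (z.1.1, z.2))
      ≤ e ^ (m + 2) * κ *
        ∫⁻ z in B.nearDiagonal (2 * ρ), esq (ψ z.1 - ψ (z.1.1, z.2)) := by
    refine lintegral_sections_le hS₁m hF₁ A.measurableSet_toSet (B.measurableSet_nearDiagonal _)
      (fun z => ?_) ?_
    · rw [← hcyl z.1]
      exact measure_mono fun q hq => hsymm _ _ hq.1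
    · rintro q hq ⟨p, s⟩ ⟨h1, h2⟩
      have hs : ((q.1, s) : Space m) ∈ cylinder q (η * R) ρ :=
        ⟨Metric.mem_closedBall_self (by positivity), h2⟩
      refine ⟨⟨hAB q hq h1, (hAB q hq hs).2⟩, ?_⟩
      have h3 := h1.2
      rw [Metric.mem_closedBall] at h2 h3
      change |s - p.2| ≤ _
      rw [← Real.dist_eq]
      have := dist_triangle_right s p.2 q.2
      linarith
  have h₂ : ∫⁻ q in A.toSet, ∫⁻ p in {p | (q, p) ∈ S₂}, spaceOscillation ψ η (2 * R) p
      ≤ e ^ (m + 2) * κ * ∫⁻ p in B.toSet, spaceOscillation ψ η (2 * R) p := by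
    refine lintegral_sections_le hS₂m hF₂ A.measurableSet_toSet B.measurableSet_toSet
      (fun p => ?_) fun q hq p hp => hAB q hq hp
    rw [← hcyl p]
    exact measure_mono fun q hq => hsymm _ _ hq
  simp_rw [hTS]
  have he0 : e ≠ 0 := (ENNReal.ofReal_pos.2 hη).ne'
  calc _ = e⁻¹ ^ (4 + (m + 2)) * (∫⁻ q in A.toSet, ∫⁻ z in {z | (q, z) ∈ S₁},
            esq (ψ z.1 - ψ (z.1.1, z.2)))
          + e⁻¹ ^ (2 + (m + 2)) *
            ∫⁻ q in A.toSet, ∫⁻ p in {p | (q, p) ∈ S₂}, spaceOscillation ψ η (2 * R) p := by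
        rw [lintegral_add_left, lintegral_const_mul' _ _ (by finiteness),
          lintegral_const_mul' _ _ (by finiteness)]
        · rfl
        · exact (measurable_lintegral_sections hS₁m hF₁).const_mul _
    _ ≤ e⁻¹ ^ (4 + (m + 2)) * (e ^ (m + 2) * κ *
            (∫⁻ z in B.nearDiagonal (2 * ρ), esq (ψ z.1 - ψ (z.1.1, z.2))))
          + e⁻¹ ^ (2 + (m + 2)) * (e ^ (m + 2) * κ *
            ∫⁻ p in B.toSet, spaceOscillation ψ η (2 * R) p) := by gcongr
    _ = κ * ((e⁻¹ ^ (4 + (m + 2)) * e ^ (m + 2)) *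
            (∫⁻ z in B.nearDiagonal (2 * ρ), esq (ψ z.1 - ψ (z.1.1, z.2)))
          + (e⁻¹ ^ (2 + (m + 2)) * e ^ (m + 2)) *
            ∫⁻ p in B.toSet, spaceOscillation ψ η (2 * R) p) := by ring
    _ = _ := by
        rw [inv_ofReal_pow_mul_ofReal_pow hη, inv_ofReal_pow_mul_ofReal_pow hη]

/-! ### Summation over scales -/

lemma Box.volume_toSet {Q : Box m} (hQ : Q.IsParabolic) :
    volume Q.toSet = ENNReal.ofReal Q.side ^ (m + 2) := by
  have hbase : volume Q.base = ENNReal.ofReal Q.side ^ m := by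
    have h1 : Q.base = (@WithLp.ofLp 2 (Fin m → ℝ)) ⁻¹'
        (Set.univ.pi fun i => Set.Ico (Q.corner i) (Q.corner i + Q.side)) := by
      ext x; simp [Box.base]
    rw [h1, (PiLp.volume_preserving_ofLp (Fin m)).measure_preimage
      (MeasurableSet.univ_pi fun i => measurableSet_Ico).nullMeasurableSet, Real.volume_pi_Ico]
    simp
  rw [Box.toSet, Measure.volume_eq_prod, Measure.prod_prod, hbase, Box.interval, Real.volume_Ico,
    add_sub_cancel_left, hQ.2, ENNReal.ofReal_pow hQ.1.le, pow_add]

/-- The sum is geometric, hence comparable to its last nonzero term, which is at most `X²`. -/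
lemma sum_sixteen_pow_le {X : ℝ} (n : ℕ) :
    ∑ i ∈ Finset.range n, (if (4 : ℝ) ^ i ≤ X then (16 : ℝ) ^ i else 0) ≤ 2 * X ^ 2 := by
  have hgeom : ∀ n : ℕ, ∑ i ∈ Finset.range n, (16 : ℝ) ^ i ≤ 16 ^ n := by
    intro n
    induction n with
    | zero => simp
    | succ n ih =>
      rw [Finset.sum_range_succ, pow_succ]
      have : (0 : ℝ) < 16 ^ n := by positivity
      linarith
  induction n with
  | zero => simp; positivity
  | succ n ih =>
    rw [Finset.sum_range_succ]
    split_ifs with h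
    · have h1 : ∑ i ∈ Finset.range n, (if (4 : ℝ) ^ i ≤ X then (16 : ℝ) ^ i else 0) ≤ 16 ^ n := by
        refine le_trans (Finset.sum_le_sum fun i _ => ?_) (hgeom n)
        split_ifs
        · exact le_rfl
        · positivity
      have h2 : (16 : ℝ) ^ n ≤ X ^ 2 := by
        calc (16 : ℝ) ^ n = (4 ^ n) ^ 2 := by rw [← pow_mul, mul_comm, pow_mul]; norm_num
          _ ≤ X ^ 2 := by gcongr
      linarith
    · simpa using ih

lemma inv_ofReal_scale {η : ℝ} (hη : 0 < η) (i : ℕ) :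
    (ENNReal.ofReal (η * (2 : ℝ)⁻¹ ^ i))⁻¹ = ENNReal.ofReal (η⁻¹ * 2 ^ i) := by
  rw [← ENNReal.ofReal_inv_of_pos (by positivity), mul_inv, inv_pow, inv_inv]

/-- A pair of times at distance `δ` contributes only at scales `η 2^(-i)` with
`4^i ≤ 2 C η² / δ`, and `∑ 16^i` over these scales is at most a constant times `(η² / δ)²`. -/
lemma tsum_nearDiagonal_le {C : ℝ} (hC : 0 < C) {ψ : Space m → ℝ} (hψ : Continuous ψ)
    (B : Box m) {η : ℝ} (hη : 0 < η) :
    ∑' i : ℕ, (ENNReal.ofReal (η * (2 : ℝ)⁻¹ ^ i))⁻¹ ^ 4 *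
        ∫⁻ z in B.nearDiagonal (2 * (C * (η * (2 : ℝ)⁻¹ ^ i) ^ 2)), esq (ψ z.1 - ψ (z.1.1, z.2))
      ≤ ENNReal.ofReal (8 * C ^ 2) * ∫⁻ z in B.toSet ×ˢ B.interval,
          ENNReal.ofReal (|ψ z.1 - ψ (z.1.1, z.2)| ^ 2 / |z.2 - z.1.2| ^ 2) := by
  set F : Space m × ℝ → ℝ≥0∞ := fun z => esq (ψ z.1 - ψ (z.1.1, z.2)) with hF
  have hFm : Measurable F := (continuous_esq.comp (by fun_prop)).measurable
  set x : ℕ → ℝ≥0∞ := fun i => (ENNReal.ofReal (η * (2 : ℝ)⁻¹ ^ i))⁻¹ ^ 4 with hx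
  have hxt : ∀ i, x i ≠ ∞ := fun i => by
    simp only [hx, inv_ofReal_scale hη]; finiteness
  set N : ℕ → Set (Space m × ℝ) := fun i =>
    {z | |z.2 - z.1.2| ≤ 2 * (C * (η * (2 : ℝ)⁻¹ ^ i) ^ 2)} with hN
  have hNm : ∀ i, MeasurableSet (N i) := fun i =>
    measurableSet_le (by fun_prop) measurable_const
  calc _ = ∑' i, ∫⁻ z in B.toSet ×ˢ B.interval, (N i).indicator (fun z => x i * F z) z := by
        refine tsum_congr fun i => ?_
        rw [lintegral_indicator (hNm i), Measure.restrict_restrict (hNm i), Set.inter_comm,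
          lintegral_const_mul' _ _ (hxt i)]
        rfl
    _ = ∫⁻ z in B.toSet ×ˢ B.interval, ∑' i, (N i).indicator (fun z => x i * F z) z := by
        rw [lintegral_tsum]
        exact fun i => ((hFm.const_mul _).indicator (hNm i)).aemeasurable
    _ ≤ ∫⁻ z in B.toSet ×ˢ B.interval, ENNReal.ofReal (8 * C ^ 2) *
          ENNReal.ofReal (|ψ z.1 - ψ (z.1.1, z.2)| ^ 2 / |z.2 - z.1.2| ^ 2) := by
        refine lintegral_mono fun z => ?_
        rcases eq_or_ne z.2 z.1.2 with h0 | h0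
        -- On the diagonal both sides vanish.
        · have : F z = 0 := by simp [hF, h0, esq]
          simp [Set.indicator, this]
        set δ := |z.2 - z.1.2| with hδ
        have hδ0 : 0 < δ := abs_pos.2 (sub_ne_zero.2 h0)
        set d := ψ z.1 - ψ (z.1.1, z.2) with hd
        set X := 2 * C * η ^ 2 / δ with hX
        have hterm : ∀ i, (N i).indicator (fun z => x i * F z) z
            = ENNReal.ofReal ((if (4 : ℝ) ^ i ≤ X then (16 : ℝ) ^ i else 0) * (η⁻¹ ^ 4 * d ^ 2)) := by
          intro i
          have hmem : z ∈ N i ↔ (4 : ℝ) ^ i ≤ X := by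
            have e1 : 2 * (C * (η * (2 : ℝ)⁻¹ ^ i) ^ 2) = 2 * C * η ^ 2 / 4 ^ i := by
              rw [mul_pow, ← pow_mul, mul_comm i 2, pow_mul, inv_pow, inv_pow]
              norm_num [div_eq_mul_inv]; ring
            change δ ≤ _ ↔ _
            rw [e1, hX, le_div_iff₀ (by positivity), le_div_iff₀ hδ0, mul_comm]
          by_cases hz : z ∈ N i
          · rw [Set.indicator_of_mem hz, if_pos (hmem.1 hz)]
            simp only [hx, hF, esq, inv_ofReal_scale hη]
            rw [← ENNReal.ofReal_pow (by positivity), ← ENNReal.ofReal_mul (by positivity)]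
            congr 1
            rw [mul_pow, ← pow_mul, mul_comm i 4, pow_mul]; norm_num; ring
          · rw [Set.indicator_of_notMem hz, if_neg (mt hmem.2 hz)]
            simp
        refine ENNReal.tsum_le_of_sum_range_le fun n => ?_
        simp_rw [hterm]
        rw [← ENNReal.ofReal_sum_of_nonneg, ← Finset.sum_mul, ← ENNReal.ofReal_mul (by positivity)]
        · refine ENNReal.ofReal_le_ofReal ?_
          calc _ ≤ 2 * X ^ 2 * (η⁻¹ ^ 4 * d ^ 2) := by
                gcongr
                exact sum_sixteen_pow_le n
            _ = _ := by
                rw [hX, sq_abs]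
                field_simp
                ring
        · intro i _
          split_ifs <;> positivity
    _ = _ := lintegral_const_mul' _ _ (by finiteness)

lemma lintegral_timeCarleson_le {M : ℝ≥0} {ψ : Space m → ℝ} (hψ : Continuous ψ)
    (hM : TimeCarleson M ψ) {B : Box m} (hB : B.IsParabolic) :
    ∫⁻ z in B.toSet ×ˢ B.interval,
        ENNReal.ofReal (|ψ z.1 - ψ (z.1.1, z.2)| ^ 2 / |z.2 - z.1.2| ^ 2)
      ≤ M * volume B.toSet := by
  have hGm : Measurable fun z : Space m × ℝ =>
      ENNReal.ofReal (|ψ z.1 - ψ (z.1.1, z.2)| ^ 2 / |z.2 - z.1.2| ^ 2) := by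
    have := hψ.measurable
    fun_prop
  have h1 : ∫⁻ z in B.toSet ×ˢ B.interval,
        ENNReal.ofReal (|ψ z.1 - ψ (z.1.1, z.2)| ^ 2 / |z.2 - z.1.2| ^ 2)
      = ∫⁻ x in B.base, ∫⁻ t in B.interval, ∫⁻ s in B.interval,
        ENNReal.ofReal (|ψ (x, t) - ψ (x, s)| ^ 2 / |s - t| ^ 2) := by
    rw [Measure.volume_eq_prod, setLIntegral_prod _ hGm.aemeasurable, Box.toSet,
      Measure.volume_eq_prod, setLIntegral_prod]
    exact hGm.lintegral_prod_right'.aemeasurable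
  have hv0 : volume B.toSet ≠ 0 := by
    rw [Box.volume_toSet hB]
    exact pow_ne_zero _ (ENNReal.ofReal_pos.2 hB.1).ne'
  have hvt : volume B.toSet ≠ ∞ := by rw [Box.volume_toSet hB]; finiteness
  rw [h1, mul_comm]
  have h2 := hM B hB
  rwa [← ENNReal.div_eq_inv_mul, ENNReal.div_le_iff hv0 hvt, mul_comm] at h2

lemma tsum_lintegral_lintegral {α β : Type*} [MeasurableSpace α] [MeasurableSpace β]
    {μ : Measure α} {ν : Measure β} [SFinite ν] {G : ℕ → α → β → ℝ≥0∞}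
    (hG : ∀ i, Measurable fun z : α × β => G i z.1 z.2) :
    ∑' i, ∫⁻ a, ∫⁻ b, G i a b ∂ν ∂μ = ∫⁻ a, ∫⁻ b, ∑' i, G i a b ∂ν ∂μ := by
  rw [← lintegral_tsum fun i => (hG i).lintegral_prod_right'.aemeasurable]
  refine lintegral_congr fun a => ?_
  have ha : ∀ i, Measurable (G i a) := fun i => (hG i).comp measurable_prodMk_left
  exact (lintegral_tsum fun i => (ha i).aemeasurable).symm

/-- The sum over scales of the deviations from affine functions at fixed times. -/
lemma exists_tsum_spaceOscillation_le (m : ℕ) {R : ℝ} (hR : 0 ≤ R) :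
    ∃ K : ℝ≥0∞, K ≠ ∞ ∧ ∀ (ψ : Space m → ℝ) (L : ℝ≥0), Continuous ψ → HorizontallyLipschitz L ψ →
      ∀ (B : Box m) (c : EuclideanSpace ℝ (Fin m)) (ρ η : ℝ), 0 < η →
      B.base ⊆ Metric.closedBall c ρ →
      ∑' i : ℕ, (ENNReal.ofReal (η * (2 : ℝ)⁻¹ ^ i))⁻¹ ^ 2 *
        ∫⁻ p in B.toSet, spaceOscillation ψ (η * (2 : ℝ)⁻¹ ^ i) R p
      ≤ K * ((ENNReal.ofReal η)⁻¹ ^ 2 * volume B.interval *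
          (esq (L * (η * ((m + 1) * (R + 1)))) *
            volume (Metric.closedBall c (ρ + 2 * (η * ((m + 1) * (R + 1))))))) := by
  obtain ⟨K, hK, h⟩ := exists_scaleEnergy_affineDefect_le m hR
  refine ⟨volume (Metric.closedBall (0 : EuclideanSpace ℝ (Fin m)) R) * K,
    ENNReal.mul_ne_top measure_closedBall_lt_top.ne hK, ?_⟩
  intro ψ L hψ hL B c ρ η hη hB
  set E := esq (L * (η * ((m + 1) * (R + 1)))) *
            volume (Metric.closedBall c (ρ + 2 * (η * ((m + 1) * (R + 1))))) with hE
  set e := ENNReal.ofReal η with he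
  have hD : ∀ i : ℕ, Measurable fun z : Space m × EuclideanSpace ℝ (Fin m) =>
      esq (affineDefect (fun x => ψ (x, z.1.2)) (η * (2 : ℝ)⁻¹ ^ i) z.1.1 z.2) := fun i =>
    measurable_affineDefect hψ _
  have hscale : ∀ i : ℕ, (ENNReal.ofReal (η * (2 : ℝ)⁻¹ ^ i))⁻¹ ^ 2 = e⁻¹ ^ 2 * esq (2 ^ i) := by
    intro i
    rw [inv_ofReal_scale hη, ENNReal.ofReal_mul (by positivity), mul_pow,
      ENNReal.ofReal_inv_of_pos hη, esq,
      ENNReal.ofReal_pow (by positivity : (0 : ℝ) ≤ 2 ^ i) 2]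
  -- For a fixed time, the order of integration puts the base point innermost.
  set G : ℕ → ℝ → EuclideanSpace ℝ (Fin m) → ℝ≥0∞ := fun i s w =>
    esq (2 ^ i) * ∫⁻ y in Metric.closedBall c ρ,
      esq (affineDefect (fun x => ψ (x, s)) (η * (2 : ℝ)⁻¹ ^ i) y w) with hG
  have hGm : ∀ i, Measurable fun z : ℝ × EuclideanSpace ℝ (Fin m) => G i z.1 z.2 := by
    intro i
    refine Measurable.const_mul ?_ _
    have : Measurable fun z : (ℝ × EuclideanSpace ℝ (Fin m)) × EuclideanSpace ℝ (Fin m) =>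
        esq (affineDefect (fun x => ψ (x, z.1.1)) (η * (2 : ℝ)⁻¹ ^ i) z.2 z.1.2) :=
      (hD i).comp (f := fun z : (ℝ × EuclideanSpace ℝ (Fin m)) × EuclideanSpace ℝ (Fin m) =>
        (((z.2, z.1.1) : Space m), z.1.2)) (by fun_prop)
    exact this.lintegral_prod_right'
  have hterm : ∀ i : ℕ, (ENNReal.ofReal (η * (2 : ℝ)⁻¹ ^ i))⁻¹ ^ 2 *
        ∫⁻ p in B.toSet, spaceOscillation ψ (η * (2 : ℝ)⁻¹ ^ i) R p
      ≤ e⁻¹ ^ 2 * ∫⁻ s in B.interval, ∫⁻ w in Metric.closedBall 0 R, G i s w := by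
    intro i
    rw [hscale, mul_assoc]
    refine mul_le_mul_right ?_ _
    rw [← lintegral_const_mul' _ _ (esq_ne_top _), Box.toSet, Measure.volume_eq_prod,
      setLIntegral_prod_symm _ ((measurable_spaceOscillation hψ _ R).const_mul _).aemeasurable]
    refine lintegral_mono fun s => ?_
    have hDs : Measurable fun z : EuclideanSpace ℝ (Fin m) × EuclideanSpace ℝ (Fin m) =>
        esq (affineDefect (fun x => ψ (x, s)) (η * (2 : ℝ)⁻¹ ^ i) z.1 z.2) :=
      (hD i).comp (f := fun z : EuclideanSpace ℝ (Fin m) × EuclideanSpace ℝ (Fin m) =>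
        (((z.1, s) : Space m), z.2)) (by fun_prop)
    have hDs' := hDs.comp measurable_swap
    calc _ ≤ ∫⁻ y in Metric.closedBall c ρ,
          esq (2 ^ i) * spaceOscillation ψ (η * (2 : ℝ)⁻¹ ^ i) R (y, s) := lintegral_mono_set hB
      _ = esq (2 ^ i) * ∫⁻ w in Metric.closedBall 0 R, ∫⁻ y in Metric.closedBall c ρ,
          esq (affineDefect (fun x => ψ (x, s)) (η * (2 : ℝ)⁻¹ ^ i) y w) := by
          rw [lintegral_const_mul' _ _ (esq_ne_top _)]
          congr 1
          exact lintegral_lintegral_swap hDs.aemeasurable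
      _ = _ := by
          rw [← lintegral_const_mul' _ _ (esq_ne_top _)]
  calc _ ≤ ∑' i, e⁻¹ ^ 2 * ∫⁻ s in B.interval, ∫⁻ w in Metric.closedBall 0 R, G i s w :=
        ENNReal.tsum_le_tsum hterm
    _ = e⁻¹ ^ 2 * ∫⁻ s in B.interval, ∫⁻ w in Metric.closedBall 0 R, ∑' i, G i s w := by
        rw [ENNReal.tsum_mul_left, tsum_lintegral_lintegral hGm]
    _ ≤ e⁻¹ ^ 2 * ∫⁻ s in B.interval, ∫⁻ w in Metric.closedBall (0 : EuclideanSpace ℝ (Fin m)) R,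
          K * E := by
        refine mul_le_mul_right (lintegral_mono fun s => ?_) _
        refine setLIntegral_mono' measurableSet_closedBall fun w hw => ?_
        exact h (fun x => ψ (x, s)) L (by fun_prop) L.2 (fun x y => hL x y s) c ρ η hη.le w
          (mem_closedBall_zero_iff.1 hw)
    _ = _ := by
        simp only [lintegral_const, Measure.restrict_apply_univ]
        ring

/-! ### Dyadic boxes and conclusion -/

lemma dyadicBox_isParabolic (j : ℤ) (k : Fin m → ℤ) (l : ℤ) : (dyadicBox j k l).IsParabolic := by
  refine ⟨by simp only [dyadicBox]; positivity, ?_⟩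
  simp only [dyadicBox]
  rw [← zpow_natCast, ← zpow_mul]
  congr 1; push_cast; ring

lemma isParabolic_of_mem_dyadicBoxes {Q : Box m} (hQ : Q ∈ dyadicBoxes m) : Q.IsParabolic := by
  obtain ⟨j, k, l, rfl⟩ := hQ
  exact dyadicBox_isParabolic j k l

lemma countable_dyadicBoxes (m : ℕ) : (dyadicBoxes m).Countable := by
  refine (Set.countable_range fun z : ℤ × (Fin m → ℤ) × ℤ => dyadicBox z.1 z.2.1 z.2.2).mono ?_
  rintro _ ⟨j, k, l, rfl⟩
  exact ⟨(j, k, l), rfl⟩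

/-- Dyadic boxes of the same generation which share a point coincide. -/
lemma eq_of_mem_toSet_of_side_eq {Q Q' : Box m} (hQ : Q ∈ dyadicBoxes m) (hQ' : Q' ∈ dyadicBoxes m)
    (hside : Q.side = Q'.side) {q : Space m} (hq : q ∈ Q.toSet) (hq' : q ∈ Q'.toSet) : Q = Q' := by
  obtain ⟨j, k, l, rfl⟩ := hQ
  obtain ⟨j', k', l', rfl⟩ := hQ'
  have hj : j = j' := by
    have := zpow_right_injective₀ (by norm_num : (0 : ℝ) < 2) (by norm_num) hside
    linarith
  subst hj
  have hle : ∀ (a b : ℤ) (η x : ℝ), 0 < η → a * η ≤ x → x < b * η + η → a ≤ b := by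
    intro a b η x hη h1 h2
    have : (a : ℝ) < b + 1 := by
      refine lt_of_mul_lt_mul_right ?_ hη.le
      linarith
    exact Int.lt_add_one_iff.1 (by exact_mod_cast this)
  obtain ⟨hx, ht⟩ := hq
  obtain ⟨hx', ht'⟩ := hq'
  have hpos : ∀ z : ℤ, (0 : ℝ) < 2 ^ z := fun z => by positivity
  have hk : k = k' := funext fun i =>
    le_antisymm (hle _ _ _ _ (hpos (-j)) (hx i).1 (hx' i).2)
      (hle _ _ _ _ (hpos (-j)) (hx' i).1 (hx i).2)
  have hl : l = l' :=
    le_antisymm (hle _ _ _ _ (hpos (-(2 * j))) ht.1 ht'.2)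
      (hle _ _ _ _ (hpos (-(2 * j))) ht'.1 ht.2)
  rw [hk, hl]

/-- The time intervals are compared, since for `m = 0` the bases carry no information. -/
lemma exists_side_eq_of_toSet_subset {Q Q₀ : Box m} (hQ : Q ∈ dyadicBoxes m)
    (hQ₀ : Q₀ ∈ dyadicBoxes m) (hsub : Q.toSet ⊆ Q₀.toSet) :
    ∃ i : ℕ, Q.side = Q₀.side * (2 : ℝ)⁻¹ ^ i := by
  have hP := isParabolic_of_mem_dyadicBoxes hQ
  have hP₀ := isParabolic_of_mem_dyadicBoxes hQ₀
  have hint : Q.interval ⊆ Q₀.interval := fun t ht =>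
    (hsub (show ((Q.corner, t) : Space m) ∈ Q.toSet from
      ⟨fun i => ⟨le_rfl, by linarith [hP.1]⟩, ht⟩)).2
  have hh : 0 < Q.height := by rw [hP.2]; exact pow_pos hP.1 2
  have hle : Q.height ≤ Q₀.height := by
    have := (Set.Ico_subset_Ico_iff (by linarith)).1 hint
    linarith [this.1, this.2]
  rw [hP.2, hP₀.2] at hle
  have hside : Q.side ≤ Q₀.side := le_of_sq_le_sq hle hP₀.1.le
  obtain ⟨j, k, l, rfl⟩ := hQ
  obtain ⟨j₀, k₀, l₀, rfl⟩ := hQ₀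
  simp only [dyadicBox] at hside ⊢
  have hj : j₀ ≤ j := by
    have := (zpow_le_zpow_iff_right₀ (by norm_num : (1 : ℝ) < 2)).1 hside
    linarith
  obtain ⟨i, rfl⟩ := Int.le.dest hj
  refine ⟨i, ?_⟩
  rw [neg_add, zpow_add₀ (by norm_num), zpow_neg _ (i : ℤ), zpow_natCast, inv_pow]

/-- A sum over dyadic boxes is bounded, generation by generation, by an integral over `Q₀`, since
the boxes of one generation are disjoint. -/
lemma tsum_dyadic_le {Q₀ : Box m} (hQ₀ : Q₀ ∈ dyadicBoxes m) (β : Box m → ℝ≥0∞)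
    (Φ : ℕ → Space m → ℝ≥0∞)
    (h : ∀ i, ∀ Q ∈ dyadicBoxes m, Q.side = Q₀.side * (2 : ℝ)⁻¹ ^ i →
      ∀ q ∈ Q.toSet, β Q ≤ Φ i q) :
    ∑' Q : {Q : Box m // Q ∈ dyadicBoxes m ∧ Q.toSet ⊆ Q₀.toSet}, β Q.1 * volume Q.1.toSet
      ≤ ∑' i, ∫⁻ q in Q₀.toSet, Φ i q := by
  choose g hg using fun Q : {Q : Box m // Q ∈ dyadicBoxes m ∧ Q.toSet ⊆ Q₀.toSet} =>
    exists_side_eq_of_toSet_subset Q.2.1 hQ₀ Q.2.2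
  have : Countable {Q : Box m // Q ∈ dyadicBoxes m ∧ Q.toSet ⊆ Q₀.toSet} :=
    ((countable_dyadicBoxes m).mono fun Q hQ => hQ.1).to_subtype
  rw [← (Equiv.sigmaFiberEquiv g).tsum_eq, ENNReal.tsum_sigma']
  refine ENNReal.tsum_le_tsum fun i => ?_
  calc _ ≤ ∑' Q : {Q // g Q = i}, ∫⁻ q in Q.1.1.toSet, Φ i q := by
        refine ENNReal.tsum_le_tsum fun Q => ?_
        have hm := Q.1.1.measurableSet_toSet
        change β Q.1.1 * volume Q.1.1.toSet ≤ _
        rw [← Measure.restrict_apply_univ, ← lintegral_const]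
        refine setLIntegral_mono' hm fun q hq => h i _ Q.1.2.1 ?_ q hq
        rw [hg, Q.2]
    _ = ∫⁻ q in ⋃ Q : {Q // g Q = i}, Q.1.1.toSet, Φ i q := by
        refine (lintegral_iUnion (fun Q => Q.1.1.measurableSet_toSet) ?_ _).symm
        intro Q Q' hne
        refine Set.disjoint_left.2 fun q hq hq' => hne ?_
        refine Subtype.ext (Subtype.ext ?_)
        refine eq_of_mem_toSet_of_side_eq Q.1.2.1 Q'.1.2.1 ?_ hq hq'
        rw [hg, hg, Q.2, Q'.2]
    _ ≤ _ := lintegral_mono_set (Set.iUnion_subset fun Q => Q.1.2.2)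

/-- The parabolic box of side-length `N` times that of `Q`, centred at the corner `(Q.corner, Q.start)`
of `Q`. Its height is scaled by `N²`, unlike that of `Box.dilate`. -/
noncomputable def Box.window (N : ℝ) (Q : Box m) : Box m where
  corner := WithLp.toLp 2 fun i => Q.corner i - N / 2 * Q.side
  side := N * Q.side
  start := Q.start - N ^ 2 / 2 * Q.side ^ 2
  height := (N * Q.side) ^ 2

lemma Box.cylinder_subset_window {C : ℝ} (hC : 1 ≤ C) {Q : Box m} (hQ : Q.IsParabolic) {η : ℝ}
    (hη : 0 < η) (hηQ : η ≤ Q.side) {q : Space m} (hq : q ∈ Q.toSet) :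
    cylinder q (η * ((m + 1) * C)) (C * η ^ 2) ⊆ (Q.window (4 * ((m + 1) * C))).toSet := by
  obtain ⟨hs, hh⟩ := hQ
  obtain ⟨hu, hτ⟩ := hq
  set R : ℝ := (m + 1) * C with hR
  have hCR : C ≤ R := by
    have : (0 : ℝ) ≤ m := Nat.cast_nonneg m
    rw [hR]; nlinarith
  have hR1 : 1 ≤ R := hC.trans hCR
  have hηR : η * R ≤ Q.side * R := by gcongr
  have hη2 : C * η ^ 2 ≤ R ^ 2 * Q.side ^ 2 := by
    have : C ≤ R ^ 2 := by nlinarith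
    gcongr
  have hsR : Q.side ≤ Q.side * R := by nlinarith
  have hs2 : Q.side ^ 2 ≤ R ^ 2 * Q.side ^ 2 := by
    have : 1 ≤ R ^ 2 := by nlinarith
    nlinarith [sq_nonneg Q.side]
  have hs2' : 0 < Q.side ^ 2 := by positivity
  rintro ⟨x, t⟩ ⟨hx, ht⟩
  rw [Metric.mem_closedBall] at hx ht
  refine ⟨fun i => ?_, ?_⟩
  · have h1 : |x i - q.1 i| ≤ η * R := by
      rw [dist_eq_norm] at hx
      exact (PiLp.norm_apply_le (x - q.1) i).trans hx
    have h2 := hu i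
    have h3 := abs_le.1 h1
    simp only [Box.window, Set.mem_Ico]
    constructor <;> linarith [h2.1, h2.2, h3.1, h3.2]
  · rw [Real.dist_eq] at ht
    have h3 := abs_le.1 ht
    simp only [Box.interval, hh, Set.mem_Ico] at hτ
    simp only [Box.window, Box.interval, Set.mem_Ico, mul_pow]
    constructor <;> nlinarith [hτ.1, hτ.2, h3.1, h3.2]

lemma Box.window_base_subset {N : ℝ} {Q : Box m} :
    (Q.window N).base ⊆ Metric.closedBall Q.corner (Q.side * (m * (N / 2))) := by
  intro x hx
  rw [Metric.mem_closedBall, dist_eq_norm]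
  refine (norm_le_of_forall_abs_le (b := N / 2 * Q.side) fun i => ?_).trans (by linarith)
  have h := hx i
  simp only [Box.window, Set.mem_Ico] at h
  rw [PiLp.sub_apply, abs_le]
  constructor <;> linarith [h.1, h.2]

/-- The packing estimate for the restricted numbers, with an extended nonnegative real constant. -/
lemma exists_tsum_restrictedBeta₂_le (m : ℕ) {C : ℝ} (hC : 1 ≤ C) :
    ∃ K : ℝ≥0∞, K ≠ ∞ ∧ ∀ (L M : ℝ≥0) (ψ : Space m → ℝ), Continuous ψ →
      HorizontallyLipschitz L ψ → TimeCarleson M ψ → ∀ Q₀ ∈ dyadicBoxes m,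
        ∑' Q : {Q : Box m // Q ∈ dyadicBoxes m ∧ Q.toSet ⊆ Q₀.toSet},
            restrictedBeta₂ L ψ (Q.1.dilate C).toSet ^ 2 * volume Q.1.toSet
          ≤ K * (L ^ 2 + M) * volume Q₀.toSet := by
  have hC0 : 0 < C := zero_lt_one.trans_le hC
  set R : ℝ := (m + 1) * C with hR
  have hR0 : 0 < R := by positivity
  obtain ⟨K₁, hK₁, hbeta⟩ := exists_restrictedBeta₂_sq_le m hC
  obtain ⟨K₂, hK₂, hover⟩ := exists_lintegral_restrictedBeta₂_bound_le m hC
  obtain ⟨K₃, hK₃, hspace⟩ := exists_tsum_spaceOscillation_le m (R := 2 * R) (by positivity)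
  set N : ℝ := 4 * R with hN
  set N' : ℝ := (m + 1) * (2 * R + 1) with hN'
  set V := volume (Metric.closedBall (0 : EuclideanSpace ℝ (Fin m)) (m * (N / 2) + 2 * N')) with hV
  have hVt : V ≠ ∞ := measure_closedBall_lt_top.ne
  set n := ENNReal.ofReal N with hn
  set kt := ENNReal.ofReal (8 * C ^ 2) * n ^ (m + 2) with hkt
  set ks := K₃ * (n ^ 2 * esq N' * V) with hks
  refine ⟨K₁ * K₂ * (kt + ks), ?_, ?_⟩
  · have := esq_ne_top N'
    finiteness
  intro L M ψ hψ hL hM Q₀ hQ₀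
  have hP₀ := isParabolic_of_mem_dyadicBoxes hQ₀
  set η := Q₀.side with hη
  have hη0 : 0 < η := hP₀.1
  set e := ENNReal.ofReal η with he
  have hxe : e⁻¹ * e = 1 :=
    ENNReal.inv_mul_cancel (ENNReal.ofReal_pos.2 hη0).ne' ENNReal.ofReal_ne_top
  have hvol₀ : volume Q₀.toSet = e ^ (m + 2) := Box.volume_toSet hP₀
  set B := Q₀.window N with hB
  have hBP : B.IsParabolic := ⟨by simp only [hB, Box.window]; positivity, rfl⟩
  have hvolB : volume B.toSet = n ^ (m + 2) * e ^ (m + 2) := by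
    rw [Box.volume_toSet hBP, ← mul_pow, ← ENNReal.ofReal_mul (by positivity)]
    rfl
  have hvolJ : volume B.interval = n ^ 2 * e ^ 2 := by
    rw [Box.interval, Real.volume_Ico, add_sub_cancel_left, hBP.2, ENNReal.ofReal_pow hBP.1.le,
      ← mul_pow, ← ENNReal.ofReal_mul (by positivity)]
    rfl
  set s : ℕ → ℝ := fun i => η * (2 : ℝ)⁻¹ ^ i with hs
  have hs0 : ∀ i, 0 < s i := fun i => by simp only [hs]; positivity
  have hsη : ∀ i, s i ≤ η := fun i =>
    mul_le_of_le_one_right hη0.le (pow_le_one₀ (by norm_num) (by norm_num))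
  set Φ : ℕ → Space m → ℝ≥0∞ := fun i q =>
    (ENNReal.ofReal (s i))⁻¹ ^ (4 + (m + 2)) *
      (∫⁻ t in Metric.closedBall q.2 (C * s i ^ 2),
        timeOscillation ψ (cylinder q (s i * R) (C * s i ^ 2)) t)
    + (ENNReal.ofReal (s i))⁻¹ ^ (2 + (m + 2)) *
      ∫⁻ p in cylinder q (s i * R) (C * s i ^ 2), spaceOscillation ψ (s i) (2 * R) p with hΦ
  have htime : ∑' i : ℕ, (ENNReal.ofReal (s i))⁻¹ ^ 4 *
        ∫⁻ z in B.nearDiagonal (2 * (C * s i ^ 2)), esq (ψ z.1 - ψ (z.1.1, z.2))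
      ≤ kt * M * e ^ (m + 2) := by
    refine (tsum_nearDiagonal_le hC0 hψ B hη0).trans ?_
    refine (mul_le_mul_right (lintegral_timeCarleson_le hψ hM hBP) _).trans (le_of_eq ?_)
    rw [hvolB, hkt]; ring
  have hspace' : ∑' i : ℕ, (ENNReal.ofReal (s i))⁻¹ ^ 2 *
        ∫⁻ p in B.toSet, spaceOscillation ψ (s i) (2 * R) p
      ≤ ks * L ^ 2 * e ^ (m + 2) := by
    refine (hspace ψ L hψ hL B Q₀.corner (η * (m * (N / 2))) η hη0
      Box.window_base_subset).trans (le_of_eq ?_)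
    have e1 : η * (m * (N / 2)) + 2 * (η * N') = η * (m * (N / 2) + 2 * N') := by ring
    have e2 : esq L = (L : ℝ≥0∞) ^ 2 := by
      rw [esq, ENNReal.ofReal_pow (NNReal.coe_nonneg L), ENNReal.ofReal_coe_nnreal]
    have e3 : esq η = e ^ 2 := by rw [esq, ENNReal.ofReal_pow hη0.le]
    rw [e1, volume_closedBall_eq _ hη0.le _ (by positivity), hvolJ, esq_mul, esq_mul, e2, e3, hks]
    calc _ = K₃ * (n ^ 2 * esq N' * V) * L ^ 2 * e ^ (m + 2) * (e⁻¹ * e) ^ 2 := by ring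
      _ = _ := by rw [hxe, one_pow, mul_one]
  calc _ ≤ ∑' i, ∫⁻ q in Q₀.toSet, K₁ * Φ i q := by
        refine tsum_dyadic_le hQ₀ (fun Q => restrictedBeta₂ L ψ (Q.dilate C).toSet ^ 2) _ ?_
        intro i Q hQ hside q hq
        have := hbeta ψ L hψ hL Q (isParabolic_of_mem_dyadicBoxes hQ) q hq
        rwa [hside] at this
    _ = K₁ * ∑' i, ∫⁻ q in Q₀.toSet, Φ i q := by
        rw [← ENNReal.tsum_mul_left]
        exact tsum_congr fun i => lintegral_const_mul' _ _ hK₁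
    _ ≤ K₁ * ∑' i, K₂ * ((ENNReal.ofReal (s i))⁻¹ ^ 4 *
            (∫⁻ z in B.nearDiagonal (2 * (C * s i ^ 2)), esq (ψ z.1 - ψ (z.1.1, z.2)))
          + (ENNReal.ofReal (s i))⁻¹ ^ 2 *
            ∫⁻ p in B.toSet, spaceOscillation ψ (s i) (2 * R) p) := by
        refine mul_le_mul_right (ENNReal.tsum_le_tsum fun i => ?_) _
        exact hover ψ hψ Q₀ B (s i) (hs0 i) fun q hq =>
          Box.cylinder_subset_window hC hP₀ (hs0 i) (hsη i) hq
    _ ≤ K₁ * (K₂ * (kt * M * e ^ (m + 2) + ks * L ^ 2 * e ^ (m + 2))) := by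
        rw [ENNReal.tsum_mul_left, ENNReal.tsum_add]
        gcongr
    _ ≤ K₁ * (K₂ * ((kt + ks) * M * e ^ (m + 2) + (kt + ks) * L ^ 2 * e ^ (m + 2))) := by
        gcongr
        · exact le_self_add
        · exact le_add_self
    _ = _ := by rw [hvol₀]; ring

lemma beta₂_le_restrictedBeta₂ (L : ℝ≥0) (ψ : Space m → ℝ) (S : Set (Space m)) :
    beta₂ ψ S ≤ restrictedBeta₂ L ψ S :=
  le_iInf fun A => iInf_le _ A.1

end ParabolicDorronsoro

theorem theorem3p4 (m : ℕ) (C : ℝ) (hC : 1 ≤ C) :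
    ∃ K : ℝ≥0, ∀ (L M : ℝ≥0) (ψ : Space m → ℝ), Continuous ψ →
      HorizontallyLipschitz L ψ → TimeCarleson M ψ → ∀ Q₀ ∈ dyadicBoxes m,
        (∑' Q : {Q : Box m // Q ∈ dyadicBoxes m ∧ Q.toSet ⊆ Q₀.toSet},
            beta₂ ψ (Q.1.dilate C).toSet ^ 2 * volume Q.1.toSet
          ≤ K * (L ^ 2 + M) * volume Q₀.toSet) ∧
        (∑' Q : {Q : Box m // Q ∈ dyadicBoxes m ∧ Q.toSet ⊆ Q₀.toSet},
            restrictedBeta₂ L ψ (Q.1.dilate C).toSet ^ 2 * volume Q.1.toSet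
          ≤ K * (L ^ 2 + M) * volume Q₀.toSet) := by
  obtain ⟨K, hK, h⟩ := exists_tsum_restrictedBeta₂_le m hC
  refine ⟨K.toNNReal, fun L M ψ hψ hL hM Q₀ hQ₀ => ?_⟩
  rw [ENNReal.coe_toNNReal hK]
  have hr := h L M ψ hψ hL hM Q₀ hQ₀
  refine ⟨le_trans (ENNReal.tsum_le_tsum fun Q => ?_) hr, hr⟩
  gcongr
  exact beta₂_le_restrictedBeta₂ L ψ _
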